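/- For a positive integer $k$ write $[k]=\{1,\dots,k\}$ (and $[0]=\emptyset$). A matching is a collection of pairwise disjoint (distinct) sets, and $\nu(\mathcal F)$ is the maximum size of a matching contained in $\mathcal F$. A family $\mathcal F\subset 2^{[n]}$ is called shifted if, whenever $\{a_1<\dots<a_k\}\in\mathcal F$ and $\{b_1<\dots<b_k\}\subset[n]$ satisfy $b_i\le a_i$ for all $i$, also $\{b_1,\dots,b_k\}\in\mathcal F$. Let $y_{\mathcal F}(i)$ denote the number of $i$-element subsets of $[n]$ that are not in $\mathcal F$. Let $m\ge 2$ and $c\ge 1$ be fixed integers. For an integer $s\ge c$ put $n=ms+c$, $\ell=s-c$ and \[ \mathcal Q(m,s,\ell)=\{P\subset[n]: |P|+|P\cap[ms-c-1]|\ge 2m\},\qquad \mathcal W(m,s,\ell)=\{P\subset[n]: |P\cap[ms-1]|\ge m\}. \] Then there is a constant $K$, depending only on $m$ and $c$, such that for every $s\ge c$ and every shifted family $\mathcal F\subset 2^{[n]}$ with $\nu(\mathcal F)<s$ the inequality \[ y_{\mathcal F}(m)+y_{\mathcal F}(m+1)\ \ge\ (2c+2)\binom{n}{m-1}-K s^{m-2}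 \] (that is, $y_{\mathcal F}(m)+y_{\mathcal F}(m+1)\ge(2c+2)\binom{n}{m-1}+O(s^{m-2})$ as $s\to\infty$ with $m,c$ fixed) holds if one of the following is satisfied: 1. $c\ge 2$ and $\mathcal F\not\subset\mathcal Q(m,s,\ell)$; 2. $c=1$, $\mathcal F\not\subset\mathcal Q(m,s,\ell)$ and $\mathcal F\not\subset\mathcal W(m,s,\ell)$. -/

import Mathlib

namespace SetFamily

/-- The ground interval `[k] = {1, …, k}` (empty for `k = 0`). -/
def seg (k : ℕ) : Finset ℕ := Finset.Icc 1 k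

/-- `M` is a matching: its members are pairwise disjoint (distinct) sets. -/
def IsMatching (M : Finset (Finset ℕ)) : Prop :=
  (M : Set (Finset ℕ)).PairwiseDisjoint id

open Classical in
/-- The matching number `ν(F)`: the maximum size of a matching contained in `F`. -/
noncomputable def matchingNumber (F : Finset (Finset ℕ)) : ℕ :=
  (F.powerset.filter IsMatching).sup Finset.card

/-- `A = (a₁ < … < a_k)` can be shifted to `B = (b₁ < … < b_k)`: the two sets have the same size
and `b_i ≤ a_i` for every `i`. -/
def CanShiftTo (A B : Finset ℕ) : Prop :=
  ∃ h : B.card = A.card, ∀ i : Fin A.card, B.orderEmbOfFin h i ≤ A.orderEmbOfFin rfl i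

/-- A family `F` of subsets of `[n]` is shifted: if `A ∈ F` and `A` can be shifted to `B ⊆ [n]`,
then `B ∈ F`. -/
def IsShifted (n : ℕ) (F : Finset (Finset ℕ)) : Prop :=
  ∀ A ∈ F, ∀ B : Finset ℕ, B ⊆ seg n → CanShiftTo A B → B ∈ F

/-- `y_F(i)`: the number of `i`-element subsets of `[n]` that are not in `F`. -/
def missing (n : ℕ) (F : Finset (Finset ℕ)) (i : ℕ) : ℕ :=
  (Finset.powersetCard i (seg n) \ F).card

/-- The family `Q(m, s, ℓ)`, `ℓ = s - c`, of subsets of `[n]`, `n = m * s + c`: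
all `P` with `|P| + |P ∩ [ms - c - 1]| ≥ 2m`. -/
def familyQ (m s c : ℕ) : Finset (Finset ℕ) :=
  (seg (m * s + c)).powerset.filter
    (fun P => 2 * m ≤ P.card + (P ∩ seg (m * s - c - 1)).card)

/-- The family `W(m, s, ℓ)`, `ℓ = s - c`, of subsets of `[n]`, `n = m * s + c`:
all `P` with `|P ∩ [ms - 1]| ≥ m`. -/
def familyW (m s c : ℕ) : Finset (Finset ℕ) :=
  (seg (m * s + c)).powerset.filter (fun P => m ≤ (P ∩ seg (m * s - 1)).card)

end SetFamily

namespace SetFamily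

open Finset

/-! Call the last L elements of [n] the block, with L = 16(c+1). Take s - 1 + M pairwise disjoint
(m-1)-sets in [m, n-L], where M = 16m(c+1) of them are spares. A set A rejects a single or a pair e
of the block if A ∪ e contains no nonempty member of F. Then A ∪ e is a missing set of size m or
m+1, and it determines A and e. So it suffices that, on average over all such configurations
(`mul_choose_le_of_forall_perm`), a set rejects about 2c+2 singles and pairs. The O(1) exceptional
sets per configuration cost only O(s^(m-2)).

Call A light if it rejects at most 2c+1 singles and pairs. Rejection passes upwards by shiftedness,
so a light set must accept all parts of one of three fixed plans, each consisting of disjoint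
singles and a few pairs of the block (`accepts_of_light`, `exists_plans`). If L sets accepted the
same plan, F would contain s disjoint sets: some accepting sets receive the parts of the plan,
others receive one free element of [n-L] each by Hall's theorem, and one more member of F fits into
E₀ ∪ E (`card_accepting_lt`). That last member comes from F ⊄ Q, from F ⊄ W when c = 1, or from
compressing a light set.

Hall's condition is secured unless many sets reject many elements of [n-L], or many reject the whole
block. Either event alone gives enough weight (`le_sum_weight`); this is why the weight also counts
rejected low elements. -/

/-- A property of finite sets that is inherited by supersets and by images under injections that
do not increase any element (and keep them positive). -/
structure IsShiftUpper (G : Finset ℕ → Prop) : Prop where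
  mono : ∀ ⦃A B⦄, A ⊆ B → G A → G B
  image : ∀ ⦃A : Finset ℕ⦄ (φ : ℕ → ℕ), Set.InjOn φ A → (∀ a ∈ A, 1 ≤ φ a ∧ φ a ≤ a) →
    G A → G (A.image φ)

/-- `P` contains a member of `F`. -/
def Covers (F : Finset (Finset ℕ)) (P : Finset ℕ) : Prop := ∃ A ∈ F, A ⊆ P

/-- `P` contains a nonempty member of `F`. -/
def CoversNonempty (F : Finset (Finset ℕ)) (P : Finset ℕ) : Prop :=
  ∃ A ∈ F, A.Nonempty ∧ A ⊆ P

/-! ### Shiftedness as closure under decreasing injections. -/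

theorem orderEmbOfFin_le_of_lt_card {B : Finset ℕ} {k : ℕ} (h : B.card = k) (i : Fin k) (x : ℕ)
    (hx : (i : ℕ) < (B.filter (· ≤ x)).card) : B.orderEmbOfFin h i ≤ x := by
  by_contra! hlt
  have hsub : B.filter (· ≤ x) ⊆ (univ.filter (fun j : Fin k => j < i)).map
      (B.orderEmbOfFin h).toEmbedding := by
    intro y hy
    rw [mem_filter] at hy
    have : y ∈ Set.range (B.orderEmbOfFin h) := by simpa using hy.1
    obtain ⟨j, rfl⟩ := this
    refine mem_map.2 ⟨j, ?_, rfl⟩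
    simp only [mem_filter, mem_univ, true_and]
    exact (B.orderEmbOfFin h).lt_iff_lt.1 (lt_of_le_of_lt hy.2 hlt)
  have := card_le_card hsub
  rw [card_map] at this
  have h2 : (univ.filter (fun j : Fin k => j < i)).card = i := by
    rw [show univ.filter (fun j : Fin k => j < i) = Iio i by ext; simp, Fin.card_Iio]
  omega

/-- The first i + 1 elements of A have i + 1 distinct images, none exceeding the largest of these
elements, in whatever order φ arranges them. -/
theorem canShiftTo_image {A : Finset ℕ} {φ : ℕ → ℕ} (hφ : Set.InjOn φ A)
    (hle : ∀ a ∈ A, φ a ≤ a) : CanShiftTo A (A.image φ) := by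
  refine ⟨card_image_of_injOn hφ, fun i => orderEmbOfFin_le_of_lt_card _ _ _ ?_⟩
  set x := A.orderEmbOfFin rfl i with hx
  have hsub : ((univ.filter (fun j : Fin A.card => j ≤ i)).map
      (A.orderEmbOfFin rfl).toEmbedding).image φ ⊆ (A.image φ).filter (· ≤ x) := by
    intro y hy
    simp only [mem_image, mem_map, mem_filter, mem_univ, true_and] at hy
    obtain ⟨_, ⟨j, hj, rfl⟩, rfl⟩ := hy
    have hm : A.orderEmbOfFin rfl j ∈ A := A.orderEmbOfFin_mem rfl j
    exact mem_filter.2 ⟨mem_image_of_mem _ hm,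
      (hle _ hm).trans ((A.orderEmbOfFin rfl).le_iff_le.2 hj)⟩
  have := card_le_card hsub
  rw [card_image_of_injOn, card_map] at this
  · have h2 : (univ.filter (fun j : Fin A.card => j ≤ i)).card = i + 1 := by
      rw [show univ.filter (fun j : Fin A.card => j ≤ i) = Iic i by ext; simp, Fin.card_Iic]
    omega
  · refine hφ.mono ?_
    intro y hy
    simp only [coe_map, Set.mem_image] at hy
    obtain ⟨j, -, rfl⟩ := hy
    exact A.orderEmbOfFin_mem rfl j

theorem isShiftUpper_covers {n : ℕ} {F : Finset (Finset ℕ)} (hF : F ⊆ (seg n).powerset)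
    (hs : IsShifted n F) : IsShiftUpper (Covers F) where
  mono := fun _ _ hAB ⟨C, hC, hCA⟩ => ⟨C, hC, hCA.trans hAB⟩
  image := by
    rintro A φ hφ hle ⟨C, hC, hCA⟩
    refine ⟨C.image φ, hs C hC _ ?_ (canShiftTo_image (hφ.mono (by exact_mod_cast hCA))
      fun a ha => (hle a (hCA ha)).2), image_subset_image hCA⟩
    intro y hy
    obtain ⟨a, ha, rfl⟩ := mem_image.1 hy
    have h1 := mem_Icc.1 (mem_powerset.1 (hF hC) ha)
    have h2 := hle a (hCA ha)
    exact mem_Icc.2 ⟨h2.1, h2.2.trans h1.2⟩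

theorem isShiftUpper_coversNonempty {n : ℕ} {F : Finset (Finset ℕ)}
    (hF : F ⊆ (seg n).powerset) (hs : IsShifted n F) : IsShiftUpper (CoversNonempty F) where
  mono := fun _ _ hAB ⟨C, hC, hne, hCA⟩ => ⟨C, hC, hne, hCA.trans hAB⟩
  image := by
    rintro A φ hφ hle ⟨C, hC, hne, hCA⟩
    refine ⟨C.image φ, hs C hC _ ?_ (canShiftTo_image (hφ.mono (by exact_mod_cast hCA))
      fun a ha => (hle a (hCA ha)).2), hne.image _, image_subset_image hCA⟩
    intro y hy
    obtain ⟨a, ha, rfl⟩ := mem_image.1 hy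
    have h1 := mem_Icc.1 (mem_powerset.1 (hF hC) ha)
    have h2 := hle a (hCA ha)
    exact mem_Icc.2 ⟨h2.1, h2.2.trans h1.2⟩

theorem CoversNonempty.covers {F : Finset (Finset ℕ)} {P : Finset ℕ} (h : CoversNonempty F P) :
    Covers F P := by
  obtain ⟨A, hA, -, hAP⟩ := h
  exact ⟨A, hA, hAP⟩

/-! ### Matchings from disjoint covers. -/

theorem card_le_matchingNumber {F M : Finset (Finset ℕ)} (hMF : M ⊆ F) (hM : IsMatching M) :
    M.card ≤ matchingNumber F := by
  classical
  unfold matchingNumber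
  exact le_sup (f := Finset.card) (mem_filter.2 ⟨mem_powerset.2 hMF, hM⟩)

/-- Pairwise disjoint sets, all of which contain members of `F`, and all but at most one of which
contain nonempty members of `F`, give a matching in `F`. -/
theorem card_lt_of_pairwise_disjoint {ι : Type*} {F : Finset (Finset ℕ)} {s : ℕ}
    (hν : matchingNumber F < s) (I : Finset ι) (B : ι → Finset ℕ) (Z : Finset ℕ)
    (hZ : Covers F Z) (hB : ∀ i ∈ I, CoversNonempty F (B i))
    (hZB : ∀ i ∈ I, Disjoint Z (B i))
    (hdisj : ∀ i ∈ I, ∀ j ∈ I, i ≠ j → Disjoint (B i) (B j)) : I.card + 1 < s := by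
  classical
  obtain ⟨A₀, hA₀, hA₀Z⟩ := hZ
  choose! A hA using hB
  -- Disjoint sets are distinct as soon as one is nonempty, so only A₀ may be empty.
  have hinj : Set.InjOn A I := by
    intro i hi j hj hij
    by_contra hne
    have h1 : Disjoint (A i) (A j) :=
      (hdisj i hi j hj hne).mono (hA i hi).2.2 (hA j hj).2.2
    rw [hij, disjoint_self_iff_empty] at h1
    exact (hA j hj).2.1.ne_empty h1
  have hnot : A₀ ∉ I.image A := by
    intro h
    obtain ⟨i, hi, rfl⟩ := mem_image.1 h
    have h1 : Disjoint (A i) (A i) := (hZB i hi).mono hA₀Z (hA i hi).2.2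
    rw [disjoint_self_iff_empty] at h1
    exact (hA i hi).2.1.ne_empty h1
  have hcard : (insert A₀ (I.image A)).card = I.card + 1 := by
    rw [card_insert_of_notMem hnot, card_image_of_injOn hinj]
  rw [← hcard]
  refine lt_of_le_of_lt (card_le_matchingNumber ?_ ?_) hν
  · intro x hx
    rcases mem_insert.1 hx with rfl | hx
    · exact hA₀
    · obtain ⟨i, hi, rfl⟩ := mem_image.1 hx
      exact (hA i hi).1
  · intro x hx y hy hxy
    simp only [coe_insert, coe_image, Set.mem_insert_iff, Set.mem_image, mem_coe] at hx hy
    change Disjoint x y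
    rcases hx with rfl | ⟨i, hi, rfl⟩ <;> rcases hy with rfl | ⟨j, hj, rfl⟩
    · exact absurd rfl hxy
    · exact (hZB j hj).mono hA₀Z (hA j hj).2.2
    · exact ((hZB i hi).mono hA₀Z (hA i hi).2.2).symm
    · exact (hdisj i hi j hj (fun h => hxy (by rw [h]))).mono (hA i hi).2.2 (hA j hj).2.2

/-! ### Compression and replacement of elements. -/

namespace IsShiftUpper

variable {G : Finset ℕ → Prop}

/-- Elements up to `d` are compressed to the start of `ℕ`, those beyond `d` to the right of `d`. -/
theorem compress (hG : IsShiftUpper G) {P : Finset ℕ} (hP : ∀ p ∈ P, 1 ≤ p) (d a b : ℕ)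
    (ha : (P.filter (· ≤ d)).card ≤ a) (hb : (P.filter (d < ·)).card ≤ b) (h : G P) :
    G (Icc 1 a ∪ Ioc d (d + b)) := by
  -- r e p is the rank of p among the elements of P beyond e; φ below replaces elements by ranks on
  -- either side of d.
  set r : ℕ → ℕ → ℕ := fun e p => (P.filter (fun x => e < x ∧ x ≤ p)).card with hr
  have hle : ∀ e p, r e p ≤ p - e := by
    intro e p
    have : P.filter (fun x => e < x ∧ x ≤ p) ⊆ Ioc e p := by
      intro x hx
      exact mem_Ioc.2 (mem_filter.1 hx).2
    simpa using card_le_card this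
  have hpos : ∀ e p, p ∈ P → e < p → 1 ≤ r e p := fun e p hp he =>
    card_pos.2 ⟨p, mem_filter.2 ⟨hp, he, le_rfl⟩⟩
  have hlt : ∀ e p q, q ∈ P → e < q → p < q → r e p < r e q := by
    intro e p q hq he hpq
    refine card_lt_card ⟨?_, ?_⟩
    · intro x hx
      rw [mem_filter] at hx ⊢
      exact ⟨hx.1, hx.2.1, by omega⟩
    · intro hsub
      have := (mem_filter.1 (hsub (mem_filter.2 ⟨hq, he, le_rfl⟩))).2.2
      omega
  set φ : ℕ → ℕ := fun p => if p ≤ d then r 0 p else d + r d p with hφ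
  have hmono : ∀ p ∈ P, ∀ q ∈ P, p < q → φ p < φ q := by
    intro p hp q hq hpq
    simp only [hφ]
    have h0 := hlt 0 p q hq (by omega) hpq
    split_ifs with h1 h2 h2
    · exact h0
    · have := hle 0 p
      have := hpos d q hq (by omega)
      omega
    · omega
    · have := hlt d p q hq (by omega) hpq
      omega
  have himg : G (P.image φ) := by
    refine hG.image φ ?_ ?_ h
    · intro p hp q hq hpq
      rcases lt_trichotomy p q with h1 | h1 | h1
      · exact absurd hpq (hmono p hp q hq h1).ne
      · exact h1
      · exact absurd hpq (hmono q hq p hp h1).ne'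
    · intro p hp
      have h1 := hP p hp
      have h2 := hle 0 p
      have h3 := hle d p
      have h4 := hpos 0 p hp (by omega)
      simp only [hφ]
      split_ifs with h5
      · omega
      · have := hpos d p hp (by omega)
        omega
  refine hG.mono ?_ himg
  intro y hy
  obtain ⟨p, hp, rfl⟩ := mem_image.1 hy
  have h1 := hP p hp
  simp only [hφ, mem_union, mem_Icc, mem_Ioc]
  split_ifs with h2
  · left
    refine ⟨hpos 0 p hp (by omega), le_trans (card_le_card ?_) ha⟩
    intro x hx
    rw [mem_filter] at hx ⊢
    exact ⟨hx.1, by omega⟩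
  · right
    have h3 := hpos d p hp (by omega)
    have h4 : r d p ≤ b := by
      refine le_trans (card_le_card ?_) hb
      intro x hx
      rw [mem_filter] at hx ⊢
      exact ⟨hx.1, hx.2.1⟩
    omega

theorem union_image (hG : IsShiftUpper G) {A e : Finset ℕ} (ψ : ℕ → ℕ) (hA : ∀ a ∈ A, 1 ≤ a)
    (hinj : Set.InjOn ψ e) (hψ : ∀ x ∈ e, 1 ≤ ψ x ∧ ψ x ≤ x) (hdisj : ∀ x ∈ e, ψ x ∉ A)
    (hAe : Disjoint A e) (h : G (A ∪ e)) : G (A ∪ e.image ψ) := by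
  classical
  set φ : ℕ → ℕ := fun x => if x ∈ A then x else ψ x with hφ
  have hnot : ∀ x ∈ e, x ∉ A := fun x hx hxA => disjoint_left.1 hAe hxA hx
  have := hG.image (A := A ∪ e) φ ?_ ?_ h
  · refine hG.mono ?_ this
    intro y hy
    obtain ⟨x, hx, rfl⟩ := mem_image.1 hy
    by_cases hxA : x ∈ A
    · simp [hφ, hxA]
    · have hxe : x ∈ e := by simpa [hxA] using hx
      simp only [hφ, hxA, if_false]
      exact mem_union_right _ (mem_image_of_mem _ hxe)
  · intro x hx y hy hxy
    simp only [coe_union, Set.mem_union, mem_coe] at hx hy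
    by_cases hxA : x ∈ A <;> by_cases hyA : y ∈ A
    · simpa [hφ, hxA, hyA] using hxy
    · have hye : y ∈ e := by tauto
      simp only [hφ, hxA, hyA, if_true, if_false] at hxy
      exact absurd (hxy ▸ hxA) (hdisj y hye)
    · have hxe : x ∈ e := by tauto
      simp only [hφ, hxA, hyA, if_true, if_false] at hxy
      exact absurd (hxy ▸ hyA) (hdisj x hxe)
    · simp only [hφ, hxA, hyA, if_false] at hxy
      exact hinj (by tauto) (by tauto) hxy
  · intro x hx
    by_cases hxA : x ∈ A
    · simpa [hφ, hxA] using hA x hxA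
    · have hxe : x ∈ e := by simpa [hxA] using hx
      simpa only [hφ, hxA, if_false] using hψ x hxe

theorem insert_of_le (hG : IsShiftUpper G) {A : Finset ℕ} (hA : ∀ a ∈ A, 1 ≤ a) {x y : ℕ}
    (hx : 1 ≤ x) (hxA : x ∉ A) (hyA : y ∉ A) (hxy : x ≤ y) (h : G (insert y A)) :
    G (insert x A) := by
  have := hG.union_image (A := A) (e := {y}) (fun _ => x) hA (by simp) (by simp; omega)
    (by simpa using hxA) (by simpa using hyA) (by rwa [union_comm, ← insert_eq])
  rwa [image_singleton, union_comm, ← insert_eq] at this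

theorem pair_of_le (hG : IsShiftUpper G) {A : Finset ℕ} (hA : ∀ a ∈ A, 1 ≤ a) {x y x' y' : ℕ}
    (hx : 1 ≤ x) (hxA : x ∉ A) (hyA : y ∉ A) (hxA' : x' ∉ A) (hyA' : y' ∉ A)
    (hxy : x < y) (hxy' : x' < y') (hxx : x ≤ x') (hyy : y ≤ y') (h : G (A ∪ {x', y'})) :
    G (A ∪ {x, y}) := by
  have := hG.union_image (A := A) (e := {x', y'}) (fun z => if z = x' then x else y) hA
    (by
      intro u hu v hv huv
      simp only [coe_insert, coe_singleton, Set.mem_insert_iff, Set.mem_singleton_iff] at hu hv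
      rcases hu with rfl | rfl <;> rcases hv with rfl | rfl
      · rfl
      · simp [hxy'.ne'] at huv; omega
      · simp [hxy'.ne'] at huv; omega
      · rfl)
    (by
      intro u hu
      rcases mem_insert.1 hu with rfl | hu
      · simp; omega
      · rw [mem_singleton] at hu
        subst hu
        simp [hxy'.ne']
        omega)
    (by
      intro u hu
      split_ifs
      · exact hxA
      · exact hyA)
    (by simp [hxA', hyA']) h
  simpa [image_insert, hxy'.ne'] using this

end IsShiftUpper

/-! ### Rejected extensions and plans for the block. -/

open Classical in
/-- The elements among the last `L` ones of `[n]` whose addition to `A` does not yield `G`. -/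
noncomputable def rejectedSingles (G : Finset ℕ → Prop) (n L : ℕ) (A : Finset ℕ) : Finset ℕ :=
  (Ioc (n - L) n).filter (fun x => ¬ G (insert x A))

open Classical in
/-- The pairs among the last `L` elements of `[n]` whose addition to `A` does not yield `G`. -/
noncomputable def rejectedPairs (G : Finset ℕ → Prop) (n L : ℕ) (A : Finset ℕ) :
    Finset (Finset ℕ) :=
  ((Ioc (n - L) n).powersetCard 2).filter (fun e => ¬ G (A ∪ e))

open Classical in
/-- The elements of `[n - L]` outside `A` whose addition to `A` does not yield `G`. -/
noncomputable def rejectedLow (G : Finset ℕ → Prop) (n L : ℕ) (A : Finset ℕ) : Finset ℕ :=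
  (Icc 1 (n - L) \ A).filter (fun x => ¬ G (insert x A))

/-- The singletons in `(a, b]` and the pairs `{u i, v i}` for `i < k`. -/
def parts (a b : ℕ) (u v : ℕ → ℕ) (k : ℕ) : Finset (Finset ℕ) :=
  (Ioc a b).image singleton ∪ (range k).image (fun i => {u i, v i})

/-- Every set of `R` yields `G` when added to `A`. -/
def Accepts (G : Finset ℕ → Prop) (A : Finset ℕ) (R : Finset (Finset ℕ)) : Prop :=
  ∀ e ∈ R, G (A ∪ e)

/-- A way to use up the last `L` elements of `[n]`: the set `E` joins the initial elements `E₀`,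
and each member of `R` is to be added to a separate `(m - 1)`-set. -/
structure IsPlan (m n L c : ℕ) (E₀ E : Finset ℕ) (R : Finset (Finset ℕ)) : Prop where
  initial : E₀ ⊆ Icc 1 (m - 1)
  final : E ⊆ Ioc (n - L) n
  part : ∀ e ∈ R, e ⊆ Ioc (n - L) n ∧ Disjoint e E
  disj : ∀ e ∈ R, ∀ f ∈ R, e ≠ f → Disjoint e f
  card : R.card + c + m = L + E₀.card

theorem card_parts {a b k : ℕ} {u v : ℕ → ℕ} (hu : ∀ i < k, b < u i)
    (huv : ∀ i < k, ∀ j < k, i ≠ j → u i ≠ u j ∧ u i ≠ v j) :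
    (parts a b u v k).card = (b - a) + k := by
  rw [parts, card_union_of_disjoint, card_image_of_injective _ singleton_injective, Nat.card_Ioc,
    card_image_of_injOn, card_range]
  · intro i hi j hj hij
    by_contra hne
    have h := huv i (by simpa using hi) j (by simpa using hj) hne
    have : u i ∈ ({u j, v j} : Finset ℕ) := by
      have h2 : ({u i, v i} : Finset ℕ) = {u j, v j} := hij
      rw [← h2]; simp
    simp at this
    tauto
  · rw [disjoint_left]
    intro e he he'
    obtain ⟨x, hx, rfl⟩ := mem_image.1 he
    obtain ⟨i, hi, h⟩ := mem_image.1 he'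
    have h1 : u i ∈ ({x} : Finset ℕ) := by rw [← h]; simp
    have h2 := hu i (by simpa using hi)
    have h3 := (mem_Ioc.1 hx).2
    rw [mem_singleton] at h1
    omega

theorem disjoint_parts {a b k : ℕ} {u v : ℕ → ℕ} (hu : ∀ i < k, b < u i)
    (hv : ∀ i < k, b < v i)
    (huv : ∀ i < k, ∀ j < k, i ≠ j → u i ≠ u j ∧ u i ≠ v j ∧ v i ≠ v j) :
    ∀ e ∈ parts a b u v k, ∀ f ∈ parts a b u v k, e ≠ f → Disjoint e f := by
  intro e he f hf hne
  simp only [parts, mem_union, mem_image, mem_Ioc, mem_range] at he hf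
  rcases he with ⟨x, hx, rfl⟩ | ⟨i, hi, rfl⟩ <;> rcases hf with ⟨y, hy, rfl⟩ | ⟨j, hj, rfl⟩
  · simpa using hne
  · have := hu j hj
    have := hv j hj
    simp
    omega
  · have := hu i hi
    have := hv i hi
    simp
    omega
  · have hij : i ≠ j := fun h => hne (by rw [h])
    have h1 := huv i hi j hj hij
    have h2 := huv j hj i hi hij.symm
    simp
    omega

theorem isPlan_parts {m n L c a b k : ℕ} {u v : ℕ → ℕ} {E₀ E : Finset ℕ}
    (hE₀ : E₀ ⊆ Icc 1 (m - 1)) (hE : E ⊆ Ioc (n - L) n) (ha : n - L ≤ a) (hb : b ≤ n)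
    (hab : a ≤ b)
    (hu : ∀ i < k, b < u i ∧ u i ≤ n ∧ u i ∉ E) (hv : ∀ i < k, b < v i ∧ v i ≤ n ∧ v i ∉ E)
    (huv : ∀ i < k, ∀ j < k, i ≠ j → u i ≠ u j ∧ u i ≠ v j ∧ v i ≠ v j)
    (hEab : ∀ x ∈ E, x ≤ a ∨ b < x) (hcard : (b - a) + k + c + m = L + E₀.card) :
    IsPlan m n L c E₀ E (parts a b u v k) where
  initial := hE₀
  final := hE
  part := by
    intro e he
    simp only [parts, mem_union, mem_image, mem_Ioc, mem_range] at he
    rcases he with ⟨x, hx, rfl⟩ | ⟨i, hi, rfl⟩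
    · simp only [singleton_subset_iff, mem_Ioc, disjoint_singleton_left]
      refine ⟨by omega, fun h => ?_⟩
      have := hEab x h
      omega
    · have h1 := hu i hi
      have h2 := hv i hi
      simp only [insert_subset_iff, singleton_subset_iff, mem_Ioc, disjoint_insert_left,
        disjoint_singleton_left]
      exact ⟨⟨by omega, by omega⟩, h1.2.2, h2.2.2⟩
  disj := disjoint_parts (fun i hi => (hu i hi).1) (fun i hi => (hv i hi).1) huv
  card := by
    rw [card_parts (fun i hi => (hu i hi).1)
      (fun i hi j hj h => ⟨(huv i hi j hj h).1, (huv i hi j hj h).2.1⟩)]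
    exact hcard

theorem accepts_parts {G : Finset ℕ → Prop} {A : Finset ℕ} {a b k : ℕ} {u v : ℕ → ℕ}
    (hs : ∀ x, a < x → x ≤ b → G (insert x A)) (hp : ∀ i < k, G (A ∪ {u i, v i})) :
    Accepts G A (parts a b u v k) := by
  intro e he
  simp only [parts, mem_union, mem_image, mem_Ioc, mem_range] at he
  rcases he with ⟨x, hx, rfl⟩ | ⟨i, hi, rfl⟩
  · rw [union_comm, ← insert_eq]
    exact hs x hx.1 hx.2
  · exact hp i hi

/-! ### Light sets accept one of three plans. -/

section Light

variable {G : Finset ℕ → Prop} {m n L c : ℕ} {A : Finset ℕ}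

theorem rejectedSingles_upward (hG : IsShiftUpper G) (hm : 1 ≤ m) (hA : A ⊆ Icc m (n - L))
    {x y : ℕ} (hx : n - L < x) (hxy : x ≤ y) (h : ¬ G (insert x A)) : ¬ G (insert y A) := by
  have hA1 : ∀ a ∈ A, 1 ≤ a := fun a ha => hm.trans (mem_Icc.1 (hA ha)).1
  have hAn : ∀ z, n - L < z → z ∉ A := fun z hz hzA => by
    have := (mem_Icc.1 (hA hzA)).2
    omega
  exact fun h' => h (hG.insert_of_le hA1 (by omega) (hAn x hx) (hAn y (by omega)) hxy h')

theorem lt_card_rejectedSingles (hG : IsShiftUpper G) (hm : 1 ≤ m) (hA : A ⊆ Icc m (n - L))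
    {d : ℕ} (hd : d < L) (hL : L ≤ n) (h : ¬ G (insert (n - d) A)) :
    d < (rejectedSingles G n L A).card := by
  classical
  have hsub : Icc (n - d) n ⊆ rejectedSingles G n L A := by
    intro y hy
    rw [mem_Icc] at hy
    exact mem_filter.2 ⟨mem_Ioc.2 (by omega),
      rejectedSingles_upward hG hm hA (by omega) hy.1 h⟩
  have := card_le_card hsub
  rw [Nat.card_Icc] at this
  omega

theorem card_rejectedSingles_of_low (hG : IsShiftUpper G) (hm : 1 ≤ m) (hA : A ⊆ Icc m (n - L))
    (hL : L ≤ n) (h : ¬ G (insert (n - L + 1) A)) : L ≤ (rejectedSingles G n L A).card := by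
  rcases Nat.eq_zero_or_pos L with rfl | hL0
  · exact Nat.zero_le _
  · have := lt_card_rejectedSingles hG hm hA (d := L - 1) (by omega) hL
      (by rwa [show n - (L - 1) = n - L + 1 by omega])
    omega

theorem rejectedPairs_upward (hG : IsShiftUpper G) (hm : 1 ≤ m) (hA : A ⊆ Icc m (n - L))
    {x y x' y' : ℕ} (hx : n - L < x) (hxy : x < y) (hxy' : x' < y') (hxx : x ≤ x') (hyy : y ≤ y')
    (h : ¬ G (A ∪ {x, y})) : ¬ G (A ∪ {x', y'}) := by
  have hA1 : ∀ a ∈ A, 1 ≤ a := fun a ha => hm.trans (mem_Icc.1 (hA ha)).1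
  have hAn : ∀ z, n - L < z → z ∉ A := fun z hz hzA => by
    have := (mem_Icc.1 (hA hzA)).2
    omega
  exact fun h' => h (hG.pair_of_le hA1 (by omega) (hAn x (by omega)) (hAn y (by omega))
    (hAn x' (by omega)) (hAn y' (by omega)) hxy hxy' hxx hyy h')

/-- The pairs `{n, y}` with `n - d ≤ y < n` are rejected once the lowest of them is. -/
theorem le_card_rejectedPairs (hG : IsShiftUpper G) (hm : 1 ≤ m) (hA : A ⊆ Icc m (n - L))
    {d : ℕ} (hd0 : 0 < d) (hd : d < L) (hL : L ≤ n) (h : ¬ G (A ∪ {n - d, n})) :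
    (Ico (n - d) n).image (fun y => ({y, n} : Finset ℕ)) ⊆ rejectedPairs G n L A ∧
      ((Ico (n - d) n).image (fun y => ({y, n} : Finset ℕ))).card = d := by
  classical
  constructor
  · intro e he
    obtain ⟨y, hy, rfl⟩ := mem_image.1 he
    rw [mem_Ico] at hy
    refine mem_filter.2 ⟨mem_powersetCard.2 ⟨?_, card_pair (by omega)⟩,
      rejectedPairs_upward hG hm hA (by omega) (by omega) hy.2 hy.1 le_rfl h⟩
    simp only [insert_subset_iff, singleton_subset_iff, mem_Ioc]
    omega
  · rw [card_image_of_injOn, Nat.card_Ico]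
    · omega
    · intro y hy z hz hyz
      simp only [coe_Ico, Set.mem_Ico] at hy hz
      have : y ∈ ({z, n} : Finset ℕ) := by
        have h2 : ({y, n} : Finset ℕ) = {z, n} := hyz
        rw [← h2]; simp
      simp at this
      omega

/-- An `(m - 1)`-set that rejects few singles and pairs accepts one of the plans. -/
theorem accepts_of_light (hG : IsShiftUpper G) (hm : 1 ≤ m) (hA : A ⊆ Icc m (n - L))
    (hc : 1 ≤ c) (hLc : 2 * c + 3 ≤ L) (hL : L ≤ n)
    (hlight : (rejectedSingles G n L A).card + (rejectedPairs G n L A).card ≤ 2 * c + 1) :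
    (∀ j, Accepts G A (parts (n - L) (n - 2 * c - 1) (fun i => n - 2 * i - 1)
        (fun i => n - 2 * i) (c - j))) ∨
      Accepts G A (parts (n - L + 1) (n - 2 * c) (fun i => n - i - c) (fun i => n - i) c) ∨
      (2 ≤ c ∧ Accepts G A (parts (n - L + 1) (n - c - 1) (fun _ => n - c)
        (fun _ => n - c + 1) 1)) ∨
      (c = 1 ∧ Accepts G A (parts (n - L) (n - 2) (fun _ => 0) (fun _ => 0) 0)) := by
  classical
  have single : ∀ d < L, (rejectedSingles G n L A).card ≤ d →
      ∀ x, n - L < x → x ≤ n - d → G (insert x A) := by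
    intro d hd hle x hx hxd
    by_contra hcon
    have h2 : d < (rejectedSingles G n L A).card :=
      lt_card_rejectedSingles hG hm hA hd hL
        (rejectedSingles_upward hG hm hA hx hxd hcon)
    omega
  have pair : (rejectedPairs G n L A).card = 0 → ∀ x y, n - L < x → x < y → y ≤ n →
      G (A ∪ {x, y}) := by
    intro h0 x y hx hxy hy
    by_contra hcon
    have : ({x, y} : Finset ℕ) ∈ rejectedPairs G n L A := by
      refine mem_filter.2 ⟨mem_powersetCard.2 ⟨?_, card_pair (by omega)⟩, hcon⟩
      simp only [insert_subset_iff, singleton_subset_iff, mem_Ioc]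
      omega
    rw [card_eq_zero] at h0
    simp [h0] at this
  by_cases h1 : (rejectedSingles G n L A).card ≤ 2 * c
  swap
  -- Now 2c + 1 singles and no pairs are rejected, so all pairs are available for any j.
  · left
    intro j
    refine accepts_parts ?_ ?_
    · exact fun x hx hx' => single (2 * c + 1) (by omega) (by omega) x hx (by omega)
    · exact fun i hi => pair (by omega) _ _ (by omega) (by omega) (by omega)
  right
  -- All pairs {n-i-c, n-i} lie below {n-c, n}, so this one decides for them.
  by_cases h2 : G (A ∪ {n - c, n})
  · left
    refine accepts_parts ?_ ?_
    · exact fun x hx hx' => single (2 * c) (by omega) (by omega) x (by omega) (by omega)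
    · intro i hi
      by_contra hcon
      exact rejectedPairs_upward hG hm hA (x := n - i - c) (y := n - i) (by omega) (by omega)
        (by omega) (by omega) (by omega) hcon h2
  right
  -- The c rejected pairs {y, n} leave room for at most c + 1 rejected singles.
  obtain ⟨h3, h3c⟩ := le_card_rejectedPairs hG hm hA (d := c) (by omega) (by omega) hL h2
  have h3' := card_le_card h3
  rw [h3c] at h3'
  by_cases hc2 : 2 ≤ c
  · left
    refine ⟨hc2, accepts_parts ?_ ?_⟩
    · exact fun x hx hx' => single (c + 1) (by omega) (by omega) x (by omega) (by omega)
    · intro i _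
      by_contra hcon
      -- As c ≥ 2, {n-c, n-c+1} lies below {n-2, n-1}, which avoids n and hence is rejected pair
      -- number c + 1. With c + 1 rejected singles, n-c onwards, the total reaches 2c + 2.
      have h4 : ¬ G (A ∪ {n - 2, n - 1}) :=
        rejectedPairs_upward hG hm hA (by omega) (by omega) (by omega) (by omega) (by omega) hcon
      have h5 : c < (rejectedPairs G n L A).card := by
        rw [← h3c]
        refine card_lt_card (Finset.ssubset_iff_subset_ne.2 ⟨h3, fun heq => ?_⟩)
        have h6 : ({n - 2, n - 1} : Finset ℕ) ∈ rejectedPairs G n L A := by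
          refine mem_filter.2 ⟨mem_powersetCard.2 ⟨?_, card_pair (by omega)⟩, h4⟩
          simp only [insert_subset_iff, singleton_subset_iff, mem_Ioc]
          omega
        rw [← heq] at h6
        obtain ⟨y, -, hy⟩ := mem_image.1 h6
        have : n ∈ ({n - 2, n - 1} : Finset ℕ) := by rw [← hy]; simp
        simp at this
        omega
      have h6 : ¬ G (insert (n - c) A) := by
        intro hin
        refine h2 (hG.mono ?_ hin)
        intro z hz
        simp only [mem_insert, mem_union, mem_singleton] at hz ⊢
        tauto
      have h7 := lt_card_rejectedSingles hG hm hA (d := c) (by omega) hL h6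
      omega
  · right
    refine ⟨by omega, accepts_parts ?_ (by omega)⟩
    exact fun x hx hx' => single 2 (by omega) (by omega) x (by omega) (by omega)

/-- A set rejecting n-L+1 rejects the whole block. Otherwise it accepts n-L+1, and its own elements
can be compressed into [m-1]. This supplies the extra member for plans with E = {n-L+1}. -/
theorem low_of_light (hG : IsShiftUpper G) (hm : 1 ≤ m) (hA : A ⊆ Icc m (n - L))
    (hcard : A.card = m - 1) (hL : L ≤ n)
    (hlight : (rejectedSingles G n L A).card < L) : G (Icc 1 (m - 1) ∪ {n - L + 1}) := by
  have h1 : G (insert (n - L + 1) A) := by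
    by_contra hcon
    have := card_rejectedSingles_of_low hG hm hA hL hcon
    omega
  have h2 := hG.compress (P := insert (n - L + 1) A) ?_ (n - L) (m - 1) 1 ?_ ?_ h1
  · refine hG.mono ?_ h2
    intro x hx
    simp only [mem_union, mem_Icc, mem_Ioc, mem_singleton] at hx ⊢
    omega
  · intro p hp
    rcases mem_insert.1 hp with rfl | hp
    · omega
    · exact hm.trans (mem_Icc.1 (hA hp)).1
  · rw [← hcard]
    refine card_le_card ?_
    intro x hx
    simp only [mem_filter, mem_insert] at hx
    rcases hx with ⟨rfl | hx, h⟩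
    · omega
    · exact hx
  · rw [← card_singleton (n - L + 1)]
    refine card_le_card ?_
    intro x hx
    simp only [mem_filter, mem_insert] at hx
    rcases hx with ⟨rfl | hx, h⟩
    · simp
    · have := (mem_Icc.1 (hA hx)).2
      omega

/-- Three plans suffice for all light sets. -/
theorem exists_plans {G' : Finset ℕ → Prop} (hG : IsShiftUpper G) (hGG' : ∀ P, G P → G' P)
    (hm : 1 ≤ m) (hc : 1 ≤ c) (hLc : 2 * c + 3 ≤ L) (hL : L ≤ n)
    (hlow : G (Icc 1 (m - 1) ∪ {n - L + 1}))
    (hQ : ∃ j ≤ c, j ≤ m - 1 ∧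
      G' (Icc 1 (m - 1 - j) ∪ Ioc (n - 2 * c - 1) (n - 2 * c - 1 + (2 * j + 1))))
    (hW : c = 1 → G' (Icc 1 (m - 1) ∪ Ioc (n - 2) (n - 2 + 2))) :
    ∃ R : Fin 3 → Finset (Finset ℕ),
      (∀ k, ∃ E₀ E, IsPlan m n L c E₀ E (R k) ∧ G' (E₀ ∪ E)) ∧
      ∀ A ⊆ Icc m (n - L),
        (rejectedSingles G n L A).card + (rejectedPairs G n L A).card ≤ 2 * c + 1 →
        ∃ k, Accepts G A (R k) := by
  obtain ⟨j, hjc, hjm, hQ⟩ := hQ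
  -- E takes the lowest 2j + 1 of the top 2c + 1 elements, and the c - j pairs tile the rest.
  have hI : IsPlan m n L c (Icc 1 (m - 1 - j)) (Ioc (n - 2 * c - 1) (n - 2 * c - 1 + (2 * j + 1)))
      (parts (n - L) (n - 2 * c - 1) (fun i => n - 2 * i - 1) (fun i => n - 2 * i) (c - j)) := by
    refine isPlan_parts ?_ ?_ le_rfl (by omega) (by omega) ?_ ?_ ?_ ?_ ?_
    · exact Icc_subset_Icc_right (by omega)
    · exact Ioc_subset_Ioc (by omega) (by omega)
    · intro i hi
      simp only [mem_Ioc]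
      omega
    · intro i hi
      simp only [mem_Ioc]
      omega
    · intro i hi k hk hik
      omega
    · intro x hx
      rw [mem_Ioc] at hx
      omega
    · rw [Nat.card_Icc]
      omega
  have hII : IsPlan m n L c (Icc 1 (m - 1)) {n - L + 1}
      (parts (n - L + 1) (n - 2 * c) (fun i => n - i - c) (fun i => n - i) c) := by
    refine isPlan_parts subset_rfl ?_ (by omega) (by omega) (by omega) ?_ ?_ ?_ ?_ ?_
    · simp only [singleton_subset_iff, mem_Ioc]
      omega
    · intro i hi
      simp only [mem_singleton]
      omega
    · intro i hi
      simp only [mem_singleton]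
      omega
    · intro i hi k hk hik
      omega
    · simp
    · rw [Nat.card_Icc]
      omega
  by_cases hc2 : 2 ≤ c
  · have hIII : IsPlan m n L c (Icc 1 (m - 1)) {n - L + 1}
        (parts (n - L + 1) (n - c - 1) (fun _ => n - c) (fun _ => n - c + 1) 1) := by
      refine isPlan_parts subset_rfl ?_ (by omega) (by omega) (by omega) ?_ ?_ ?_ ?_ ?_
      · simp only [singleton_subset_iff, mem_Ioc]
        omega
      · intro i hi
        simp only [mem_singleton]
        omega
      · intro i hi
        simp only [mem_singleton]
        omega
      · intro i hi k hk hik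
        omega
      · simp
      · rw [Nat.card_Icc]
        omega
    refine ⟨![parts (n - L) (n - 2 * c - 1) (fun i => n - 2 * i - 1) (fun i => n - 2 * i) (c - j),
      parts (n - L + 1) (n - 2 * c) (fun i => n - i - c) (fun i => n - i) c,
      parts (n - L + 1) (n - c - 1) (fun _ => n - c) (fun _ => n - c + 1) 1], ?_, ?_⟩
    rotate_left
    · intro A hA hlight
      rcases accepts_of_light hG hm hA hc hLc hL hlight with h | h | ⟨-, h⟩ | ⟨h, -⟩
      · exact ⟨0, h j⟩
      · exact ⟨1, h⟩
      · exact ⟨2, h⟩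
      · omega
    · intro k
      fin_cases k
      · exact ⟨_, _, hI, hQ⟩
      · exact ⟨_, _, hII, hGG' _ hlow⟩
      · exact ⟨_, _, hIII, hGG' _ hlow⟩
  · have hIV : IsPlan m n L c (Icc 1 (m - 1)) (Ioc (n - 2) (n - 2 + 2))
        (parts (n - L) (n - 2) (fun _ => 0) (fun _ => 0) 0) := by
      refine isPlan_parts subset_rfl ?_ (by omega) (by omega) (by omega) ?_ ?_ ?_ ?_ ?_
      · exact Ioc_subset_Ioc (by omega) (by omega)
      · intro i hi
        omega
      · intro i hi
        omega
      · intro i hi k hk hik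
        omega
      · intro x hx
        rw [mem_Ioc] at hx
        omega
      · rw [Nat.card_Icc]
        omega
    refine ⟨![parts (n - L) (n - 2 * c - 1) (fun i => n - 2 * i - 1) (fun i => n - 2 * i) (c - j),
      parts (n - L + 1) (n - 2 * c) (fun i => n - i - c) (fun i => n - i) c,
      parts (n - L) (n - 2) (fun _ => 0) (fun _ => 0) 0], ?_, ?_⟩
    rotate_left
    · intro A hA hlight
      rcases accepts_of_light hG hm hA hc hLc hL hlight with h | h | ⟨h, -⟩ | ⟨-, h⟩
      · exact ⟨0, h j⟩
      · exact ⟨1, h⟩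
      · omega
      · exact ⟨2, h⟩
    · intro k
      fin_cases k
      · exact ⟨_, _, hI, hQ⟩
      · exact ⟨_, _, hII, hGG' _ hlow⟩
      · exact ⟨_, _, hIV, hW (by omega)⟩

end Light

/-! ### From a plan to a matching of s sets. -/

/-- Hall's condition for sets that accept most of `Y`, most of them all of it. -/
theorem exists_injOn_of_accept {ι : Type*} [DecidableEq ι] {K : Finset ι} {Y : Finset ℕ}
    {P : ι → ℕ → Prop} {θ q : ℕ} (hKY : K.card ≤ Y.card) (hθ : θ + q ≤ Y.card)
    (hfew : ∀ i ∈ K, ∀ S ⊆ Y, (∀ y ∈ S, ¬ P i y) → S.card ≤ θ)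
    (hall : ∀ S ⊆ K, q < S.card → ∃ i ∈ S, ∀ y ∈ Y, P i y) :
    ∃ f : ι → ℕ, Set.InjOn f K ∧ ∀ i ∈ K, f i ∈ Y ∧ P i (f i) := by
  classical
  have hHall := (Finset.all_card_le_biUnion_card_iff_exists_injective
    (fun i : K => Y.filter (P i))).1 ?_
  · obtain ⟨f, hf, hfm⟩ := hHall
    refine ⟨fun i => if h : i ∈ K then f ⟨i, h⟩ else 0, ?_, ?_⟩
    · intro i hi j hj hij
      have hi' : i ∈ K := hi
      have hj' : j ∈ K := hj
      simp only [hi', hj', dif_pos] at hij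
      exact congrArg Subtype.val (hf hij)
    · intro i hi
      simp only [hi, dif_pos]
      exact mem_filter.1 (hfm ⟨i, hi⟩)
  · intro S
    rcases S.eq_empty_or_nonempty with rfl | ⟨i₀, hi₀⟩
    · simp
    have hSK : S.card ≤ K.card := by
      simpa using card_le_card (subset_univ S)
    -- More than q sets jointly see all of Y; for at most q sets, one alone sees |Y| - θ ≥ q
    -- elements.
    by_cases hq : q < S.card
    · obtain ⟨i, hi, hY⟩ := hall (S.map (Function.Embedding.subtype _)) (by
        intro x hx
        obtain ⟨y, -, rfl⟩ := mem_map.1 hx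
        exact y.2) (by rwa [card_map])
      obtain ⟨j, hj, rfl⟩ := mem_map.1 hi
      refine (hSK.trans hKY).trans (card_le_card fun y hy => ?_)
      exact mem_biUnion.2 ⟨j, hj, mem_filter.2 ⟨hy, hY y hy⟩⟩
    · have h1 := hfew i₀ i₀.2 (Y.filter (fun y => ¬ P i₀ y)) (filter_subset _ _)
        (fun y hy => (mem_filter.1 hy).2)
      have h2 := card_filter_add_card_filter_not (s := Y) (P i₀)
      have h3 : (Y.filter (P i₀)).card ≤ (S.biUnion fun i : K => Y.filter (P i)).card :=
        card_le_card fun y hy => mem_biUnion.2 ⟨i₀, hi₀, hy⟩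
      omega

open Classical in
/-- Fewer than `L` sets of a configuration accept a given plan, unless many sets reject a lot. -/
theorem card_accepting_lt {ι : Type*} [Fintype ι] {F : Finset (Finset ℕ)}
    {m n s c L M θ q : ℕ} (hG : IsShiftUpper (CoversNonempty F)) (hν : matchingNumber F < s)
    (hm : 1 ≤ m) (hn : n = m * s + c) {A : ι → Finset ℕ} (hA : ∀ i, A i ⊆ Icc m (n - L))
    (hAcard : ∀ i, (A i).card = m - 1) (hAdisj : ∀ i j, i ≠ j → Disjoint (A i) (A j))
    (hι : Fintype.card ι = s - 1 + M)
    {E₀ E : Finset ℕ} {R : Finset (Finset ℕ)} (hplan : IsPlan m n L c E₀ E R)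
    (hE : Covers F (E₀ ∪ E))
    (hbad : (univ.filter fun i => θ < (rejectedLow (CoversNonempty F) n L (A i)).card).card ≤ M)
    (hrej : (univ.filter fun i =>
      ¬ CoversNonempty F (insert (n - L + 1) (A i))).card ≤ q)
    (hθ : θ + q + L ≤ s) :
    (univ.filter fun i => Accepts (CoversNonempty F) (A i) R).card < L := by
  have hE₀ : E₀.card ≤ m - 1 := by simpa using card_le_card hplan.initial
  have hRcard := hplan.card
  by_contra! hacc
  obtain ⟨I₀, hI₀, hI₀card⟩ := exists_subset_card_eq
    (show R.card ≤ (univ.filter fun i => Accepts (CoversNonempty F) (A i) R).card by omega)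
  have g : I₀ ≃ R := Finset.equivOfCardEq hI₀card
  set bad := univ.filter fun i => θ < (rejectedLow (CoversNonempty F) n L (A i)).card with hbaddef
  have hcompl : (univ \ I₀).card = s - 1 + M - R.card := by
    rw [card_sdiff_of_subset (subset_univ _), card_univ, hι, hI₀card]
  -- Exactly M indices are discarded, including every bad one outside I₀. The s - 1 kept ones are
  -- I₀, served by the plan, and K, served by Hall.
  obtain ⟨D, hbadD, hDI, hDcard⟩ := exists_subsuperset_card_eq
    (show bad \ I₀ ⊆ univ \ I₀ from sdiff_subset_sdiff (subset_univ _) subset_rfl)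
    ((card_le_card sdiff_subset).trans hbad) (show M ≤ (univ \ I₀).card by omega)
  set K := (univ \ I₀) \ D with hK
  have hKcard : K.card = s - 1 - R.card := by
    rw [hK, card_sdiff_of_subset hDI, hcompl, hDcard]
    omega
  set keep : Finset ι := univ \ D with hkeep
  have hkeepcard : keep.card = s - 1 := by
    rw [hkeep, card_sdiff_of_subset (subset_univ _), card_univ, hι, hDcard]
    omega
  have hkeepcases : ∀ i ∈ keep, i ∉ I₀ → i ∈ K := by
    intro i hi hi0
    simp only [hkeep, hK, mem_sdiff, mem_univ, true_and] at hi ⊢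
    exact ⟨hi0, hi⟩
  have hunion : (keep.biUnion A).card = (s - 1) * (m - 1) := by
    rw [card_biUnion (fun i _ j _ hij => hAdisj i j hij), sum_congr rfl (fun i _ => hAcard i),
      sum_const, hkeepcard, smul_eq_mul]
  set Y := (Icc 1 (n - L) \ E₀) \ keep.biUnion A with hY
  have hYcard : Y.card = n - L - E₀.card - (s - 1) * (m - 1) := by
    obtain ⟨s', rfl⟩ : ∃ s', s = s' + 1 := ⟨s - 1, by omega⟩
    obtain ⟨m', rfl⟩ : ∃ m', m = m' + 1 := ⟨m - 1, by omega⟩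
    have hn' : n = s' * m' + m' + s' + 1 + c := by rw [hn]; ring
    rw [hY, card_sdiff_of_subset, card_sdiff_of_subset, hunion, Nat.card_Icc]
    · omega
    · refine hplan.initial.trans (Icc_subset_Icc_right ?_)
      omega
    · intro x hx
      obtain ⟨i, -, hi⟩ := mem_biUnion.1 hx
      have h1 := mem_Icc.1 (hA i hi)
      rw [mem_sdiff, mem_Icc]
      refine ⟨by omega, fun h => ?_⟩
      have h2 := mem_Icc.1 (hplan.initial h)
      omega
  -- Combined with the `card` field of the plan this says |Y| = |K|: the free elements just suffice.
  have hYeq : Y.card + L + E₀.card = m + s + c - 1 := by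
    obtain ⟨s', rfl⟩ : ∃ s', s = s' + 1 := ⟨s - 1, by omega⟩
    obtain ⟨m', rfl⟩ : ∃ m', m = m' + 1 := ⟨m - 1, by omega⟩
    have hn' : n = s' * m' + m' + s' + 1 + c := by rw [hn]; ring
    simp only [Nat.add_sub_cancel] at hYcard
    omega
  have hmn : m - 1 ≤ n - L := by
    have : m - 1 + s ≤ m * s := by
      obtain ⟨s', rfl⟩ : ∃ s', s = s' + 1 := ⟨s - 1, by omega⟩
      obtain ⟨m', rfl⟩ : ∃ m', m = m' + 1 := ⟨m - 1, by omega⟩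
      have : (m' + 1) * (s' + 1) = m' * s' + m' + s' + 1 := by ring
      omega
    omega
  have hAmem : ∀ i, ∀ x ∈ A i, 1 ≤ x ∧ m ≤ x ∧ x ≤ n - L := by
    intro i x hx
    have := mem_Icc.1 (hA i hx)
    omega
  have hYmem : ∀ y ∈ Y, 1 ≤ y ∧ y ≤ n - L ∧ y ∉ E₀ ∧ ∀ i ∈ keep, y ∉ A i := by
    intro y hy
    simp only [hY, mem_sdiff, mem_Icc, mem_biUnion, not_exists, not_and] at hy
    exact ⟨hy.1.1.1, hy.1.1.2, hy.1.2, hy.2⟩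
  have hKkeep : ∀ i ∈ K, i ∈ keep := by
    intro i hi
    simp only [hkeep, hK, mem_sdiff, mem_univ, true_and] at hi ⊢
    exact hi.2
  obtain ⟨f, hfinj, hf⟩ := exists_injOn_of_accept (K := K) (Y := Y)
    (P := fun i y => CoversNonempty F (insert y (A i))) (θ := θ) (q := q) (by omega) (by omega)
    (by
      intro i hi S hSY hS
      have hgood : i ∉ bad := by
        intro hib
        simp only [hK, mem_sdiff, mem_univ, true_and] at hi
        exact hi.2 (hbadD (mem_sdiff.2 ⟨hib, hi.1⟩))
      rw [hbaddef, mem_filter] at hgood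
      simp only [mem_univ, true_and, not_lt] at hgood
      refine (card_le_card ?_).trans hgood
      intro y hy
      have h1 := hYmem y (hSY hy)
      exact mem_filter.2 ⟨mem_sdiff.2 ⟨mem_Icc.2 ⟨h1.1, h1.2.1⟩, h1.2.2.2 i (hKkeep i hi)⟩, hS y hy⟩)
    (by
      -- By shiftedness a set accepting n-L+1 accepts all of Y, so the exceptions number at most q.
      intro S hSK hS
      by_contra! hcon
      have : S.card ≤ q := by
        refine (card_le_card ?_).trans hrej
        intro i hi
        obtain ⟨y, hy, hyP⟩ := hcon i hi
        have h1 := hYmem y hy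
        refine mem_filter.2 ⟨mem_univ _, fun h => hyP ?_⟩
        refine hG.insert_of_le (fun a ha => (hAmem i a ha).1) h1.1
          (h1.2.2.2 i (hKkeep i (hSK hi))) ?_ (show y ≤ n - L + 1 by omega) h
        intro h2
        have := hAmem i _ h2
        omega
      omega)
  set z : ι → Finset ℕ := fun i => if h : i ∈ I₀ then (g ⟨i, h⟩ : Finset ℕ) else {f i} with hz
  have hz0 : ∀ i (h : i ∈ I₀), z i = (g ⟨i, h⟩ : Finset ℕ) := fun i h => by simp only [hz, h, dif_pos]
  have hz1 : ∀ i, i ∉ I₀ → z i = {f i} := fun i h => by simp [hz, h]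
  have hzmem : ∀ i ∈ keep, ∀ x ∈ z i, (n - L < x ∧ x ∉ E) ∨ x ∈ Y := by
    intro i hi x hx
    by_cases h : i ∈ I₀
    · left
      rw [hz0 i h] at hx
      have h1 := hplan.part _ (g ⟨i, h⟩).2
      exact ⟨(mem_Ioc.1 (h1.1 hx)).1, disjoint_left.1 h1.2 hx⟩
    · right
      rw [hz1 i h, mem_singleton] at hx
      rw [hx]
      exact (hf i (hkeepcases i hi h)).1
  have hzA : ∀ i ∈ keep, ∀ j ∈ keep, Disjoint (A i) (z j) := by
    intro i hi j hj
    rw [disjoint_left]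
    intro x hx hx'
    have h1 := hAmem i x hx
    rcases hzmem j hj x hx' with h2 | h2
    · omega
    · exact (hYmem x h2).2.2.2 i hi hx
  have hzz : ∀ i ∈ keep, ∀ j ∈ keep, i ≠ j → Disjoint (z i) (z j) := by
    intro i hi j hj hij
    by_cases h : i ∈ I₀ <;> by_cases h' : j ∈ I₀
    · rw [hz0 i h, hz0 j h']
      refine hplan.disj _ (g ⟨i, h⟩).2 _ (g ⟨j, h'⟩).2 fun heq => hij ?_
      exact congrArg Subtype.val (g.injective (Subtype.ext heq))
    · rw [hz0 i h, hz1 j h', disjoint_singleton_right]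
      intro hx
      have h1 := (mem_Ioc.1 ((hplan.part _ (g ⟨i, h⟩).2).1 hx)).1
      have h2 := hYmem _ (hf j (hkeepcases j hj h')).1
      omega
    · rw [hz0 j h', hz1 i h, disjoint_singleton_left]
      intro hx
      have h1 := (mem_Ioc.1 ((hplan.part _ (g ⟨j, h'⟩).2).1 hx)).1
      have h2 := hYmem _ (hf i (hkeepcases i hi h)).1
      omega
    · rw [hz1 i h, hz1 j h', disjoint_singleton]
      exact fun heq => hij (hfinj (hkeepcases i hi h) (hkeepcases j hj h') heq)
  have := card_lt_of_pairwise_disjoint hν keep (fun i => A i ∪ z i) (E₀ ∪ E) hE ?_ ?_ ?_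
  · omega
  · intro i hi
    by_cases h : i ∈ I₀
    · rw [hz0 i h]
      exact (mem_filter.1 (hI₀ h)).2 _ (g ⟨i, h⟩).2
    · rw [hz1 i h, union_comm, ← insert_eq]
      exact (hf i (hkeepcases i hi h)).2
  · intro i hi
    rw [disjoint_left]
    intro x hx hx'
    have hEx : x ∈ E → n - L < x := fun h => (mem_Ioc.1 (hplan.final h)).1
    have hE₀x : x ∈ E₀ → x ≤ m - 1 := fun h => (mem_Icc.1 (hplan.initial h)).2
    rcases mem_union.1 hx' with h | h
    · have h1 := hAmem i x h
      rcases mem_union.1 hx with h2 | h2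
      · have := hE₀x h2
        omega
      · have := hEx h2
        omega
    · rcases hzmem i hi x h with h1 | h1
      · rcases mem_union.1 hx with h2 | h2
        · have := hE₀x h2
          omega
        · exact h1.2 h2
      · have h3 := hYmem x h1
        rcases mem_union.1 hx with h2 | h2
        · exact h3.2.2.1 h2
        · have := hEx h2
          omega
  · intro i hi j hj hij
    rw [disjoint_union_left, disjoint_union_right, disjoint_union_right]
    exact ⟨⟨hAdisj i j hij, hzA i hi j hj⟩, (hzA j hj i hi).symm, hzz i hi j hj hij⟩

/-! ### Weight of one configuration. -/

/-- The weight of `A`: its rejected singles and pairs at the end of `[n]` count `m` times, the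
other rejected elements once. -/
noncomputable def weight (G : Finset ℕ → Prop) (m n L : ℕ) (A : Finset ℕ) : ℕ :=
  m * ((rejectedSingles G n L A).card + (rejectedPairs G n L A).card) + (rejectedLow G n L A).card

theorem card_mul_le_sum_weight {ι : Type*} [Fintype ι] {f : ι → ℕ} {w : ℕ} (I : Finset ι)
    (h : ∀ i ∈ I, w ≤ f i) : I.card * w ≤ ∑ i, f i := by
  rw [← smul_eq_mul]
  exact (card_nsmul_le_sum I f w h).trans (sum_le_sum_of_subset (subset_univ _))

/-- If more than M sets each reject more than θ low elements, or more than θ sets reject the whole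
block, then s ≤ 4(θ+1) and the factor 16 in M and L give weight 4m(c+1)s, which exceeds the bound.
Otherwise each of the three plans is accepted by fewer than L sets, so at most 3L sets are light. -/
theorem le_sum_weight {ι : Type*} [Fintype ι] {F : Finset (Finset ℕ)}
    {m n s c L M : ℕ} (hG : IsShiftUpper (CoversNonempty F)) (hν : matchingNumber F < s)
    (hm : 1 ≤ m) (hc : 1 ≤ c) (hn : n = m * s + c) (hL : L = 16 * (c + 1))
    (hM : M = 16 * m * (c + 1)) (hs : M + 2 * L ≤ s) {A : ι → Finset ℕ}
    (hA : ∀ i, A i ⊆ Icc m (n - L))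
    (hAcard : ∀ i, (A i).card = m - 1) (hAdisj : ∀ i j, i ≠ j → Disjoint (A i) (A j))
    (hι : Fintype.card ι = s - 1 + M)
    (hQ : ∃ j ≤ c, j ≤ m - 1 ∧
      Covers F (Icc 1 (m - 1 - j) ∪ Ioc (n - 2 * c - 1) (n - 2 * c - 1 + (2 * j + 1))))
    (hW : c = 1 → Covers F (Icc 1 (m - 1) ∪ Ioc (n - 2) (n - 2 + 2))) :
    m * (2 * c + 2) * (s - 1 + M - 3 * L) ≤ ∑ i, weight (CoversNonempty F) m n L (A i) := by
  classical
  set G := CoversNonempty F with hGdef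
  have hLn : L ≤ n := by
    have : 1 * s ≤ m * s := Nat.mul_le_mul_right s hm
    omega
  set θ := (s - L) / 2 with hθ
  have hθ4 : s ≤ 4 * (θ + 1) := by omega
  have hupper : m * (2 * c + 2) * (s - 1 + M - 3 * L) ≤ m * (2 * c + 2) * (2 * s) :=
    Nat.mul_le_mul_left _ (by omega)
  by_cases hbad : (univ.filter fun i => θ < (rejectedLow G n L (A i)).card).card ≤ M
  swap
  · have h1 := card_mul_le_sum_weight (f := fun i => weight G m n L (A i)) (w := θ + 1)
      (univ.filter fun i => θ < (rejectedLow G n L (A i)).card) (by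
        intro i hi
        have := (mem_filter.1 hi).2
        simp only [weight]
        omega)
    refine le_trans ?_ h1
    refine le_trans ?_ (Nat.mul_le_mul_right _ (not_le.1 hbad).le)
    refine hupper.trans ?_
    rw [hM]
    nlinarith [Nat.mul_le_mul_left (4 * m * (c + 1)) hθ4]
  by_cases hrej : (univ.filter fun i => ¬ G (insert (n - L + 1) (A i))).card ≤ θ
  swap
  · have h1 := card_mul_le_sum_weight (f := fun i => weight G m n L (A i)) (w := m * L)
      (univ.filter fun i => ¬ G (insert (n - L + 1) (A i))) (by
        intro i hi
        have h2 := card_rejectedSingles_of_low hG hm (hA i) hLn (mem_filter.1 hi).2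
        simp only [weight]
        have h3 : m * L ≤ m * ((rejectedSingles G n L (A i)).card +
          (rejectedPairs G n L (A i)).card) := Nat.mul_le_mul_left _ (by omega)
        omega)
    refine le_trans ?_ h1
    refine le_trans ?_ (Nat.mul_le_mul_right _ (Nat.succ_le_of_lt (not_le.1 hrej)))
    refine hupper.trans ?_
    rw [hL]
    nlinarith [Nat.mul_le_mul_left (4 * m * (c + 1)) hθ4]
  set light : Finset ι := univ.filter fun i =>
    (rejectedSingles G n L (A i)).card + (rejectedPairs G n L (A i)).card ≤ 2 * c + 1 with hlight
  have hfew : light.card ≤ 3 * L := by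
    rcases light.eq_empty_or_nonempty with h0 | ⟨i₀, hi₀⟩
    · simp [h0]
    have hi₀' := (mem_filter.1 hi₀).2
    have hlow := low_of_light hG hm (hA i₀) (hAcard i₀) hLn (by omega)
    obtain ⟨R, hR, hacc⟩ := exists_plans (G' := Covers F) hG (fun P hP => hP.covers) hm hc
      (by omega) hLn hlow hQ hW
    have hsub : light ⊆ (univ : Finset (Fin 3)).biUnion
        (fun k => univ.filter fun i => Accepts G (A i) (R k)) := by
      intro i hi
      obtain ⟨k, hk⟩ := hacc (A i) (hA i) (mem_filter.1 hi).2
      exact mem_biUnion.2 ⟨k, mem_univ _, mem_filter.2 ⟨mem_univ _, hk⟩⟩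
    refine (card_le_card hsub).trans (card_biUnion_le.trans ?_)
    refine (sum_le_card_nsmul univ _ L ?_).trans (by simp)
    intro k _
    obtain ⟨E₀, E, hplan, hE⟩ := hR k
    exact (card_accepting_lt hG hν hm hn hA hAcard hAdisj hι hplan hE hbad hrej (by omega)).le
  have h1 := card_mul_le_sum_weight (f := fun i => weight G m n L (A i)) (w := m * (2 * c + 2))
    (univ \ light) (by
      intro i hi
      simp only [hlight, mem_sdiff, mem_filter, mem_univ, true_and, not_le] at hi
      simp only [weight]
      have h3 : m * (2 * c + 2) ≤ m * ((rejectedSingles G n L (A i)).card +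
        (rejectedPairs G n L (A i)).card) := Nat.mul_le_mul_left _ hi
      omega)
  refine le_trans ?_ h1
  rw [mul_comm]
  refine Nat.mul_le_mul_right _ ?_
  rw [card_sdiff_of_subset (subset_univ _), card_univ, hι]
  omega

/-! ### Averaging over configurations. -/

/-- Averaging over all permutations: a lower bound on the sum of `f` over every image of a
configuration of `k`-sets gives a lower bound on the sum over all `k`-sets. -/
theorem mul_choose_le_of_forall_perm {α : Type*} [Fintype α] (f : Finset α → ℕ)
    {k N B : ℕ} (A : Fin N → Finset α) (hA : ∀ i, (A i).card = k)
    (h : ∀ σ : Equiv.Perm α, B ≤ ∑ i, f ((A i).map σ.toEmbedding)) :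
    B * (Fintype.card α).choose k ≤ N * ∑ S ∈ powersetCard k univ, f S := by
  classical
  -- Φ S depends only on the size of S, so every A i contributes the same average.
  set Φ : Finset α → ℕ := fun S => ∑ σ : Equiv.Perm α, f (S.map σ.toEmbedding) with hΦ
  have hinv : ∀ S T : Finset α, S.card = T.card → Φ S = Φ T := by
    intro S T hST
    obtain ⟨τ, rfl⟩ := Equiv.Perm.exists_map_finset_eq S T hST
    simp only [hΦ]
    rw [← Equiv.sum_comp (Equiv.mulRight τ)]
    refine sum_congr rfl fun σ _ => ?_
    rw [map_map]
    rfl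
  have hsum : ∑ S ∈ powersetCard k (univ : Finset α), Φ S =
      Fintype.card (Equiv.Perm α) * ∑ S ∈ powersetCard k univ, f S := by
    simp only [hΦ]
    rw [sum_comm, ← smul_eq_mul, ← card_univ, ← sum_const]
    refine sum_congr rfl fun σ _ => ?_
    refine sum_bij' (fun S _ => S.map σ.toEmbedding) (fun S _ => S.map σ.symm.toEmbedding)
      ?_ ?_ ?_ ?_ ?_
    · intro S hS
      simpa [mem_powersetCard] using hS
    · intro S hS
      simpa [mem_powersetCard] using hS
    · intro S hS
      ext x; simp
    · intro S hS
      ext x; simp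
    · intro S hS
      rfl
  have hconst : ∀ i, ∑ S ∈ powersetCard k (univ : Finset α), Φ S =
      (Fintype.card α).choose k * Φ (A i) := by
    intro i
    rw [sum_congr rfl (fun S hS => hinv S (A i) (((mem_powersetCard.1 hS).2).trans (hA i).symm)),
      sum_const, card_powersetCard, card_univ, smul_eq_mul]
  have hP : 0 < Fintype.card (Equiv.Perm α) := Fintype.card_pos
  refine Nat.le_of_mul_le_mul_left ?_ hP
  calc Fintype.card (Equiv.Perm α) * (B * (Fintype.card α).choose k)
      = (Fintype.card α).choose k * ∑ _σ : Equiv.Perm α, B := by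
        rw [sum_const, card_univ, smul_eq_mul]; ring
    _ ≤ (Fintype.card α).choose k * ∑ σ : Equiv.Perm α, ∑ i, f ((A i).map σ.toEmbedding) :=
        Nat.mul_le_mul_left _ (sum_le_sum fun σ _ => h σ)
    _ = ∑ i, (Fintype.card α).choose k * Φ (A i) := by
        rw [sum_comm, mul_sum]
    _ = ∑ _i : Fin N, Fintype.card (Equiv.Perm α) * ∑ S ∈ powersetCard k univ, f S :=
        sum_congr rfl fun i _ => by rw [← hconst i, hsum]
    _ = Fintype.card (Equiv.Perm α) * (N * ∑ S ∈ powersetCard k univ, f S) := by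
        rw [sum_const, card_univ, Fintype.card_fin, smul_eq_mul]; ring

/-- Consecutive intervals of length k give one configuration in [m, p]; every permutation of [m, p]
carries it to another. -/
theorem mul_choose_le_of_forall_disjoint (f : Finset ℕ → ℕ) {m p k N B : ℕ}
    (hN : m + N * k ≤ p + 1)
    (h : ∀ A : Fin N → Finset ℕ, (∀ i, A i ⊆ Icc m p) → (∀ i, (A i).card = k) →
      (∀ i j, i ≠ j → Disjoint (A i) (A j)) → B ≤ ∑ i, f (A i)) :
    B * (p + 1 - m).choose k ≤ N * ∑ S ∈ powersetCard k (Icc m p), f S := by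
  classical
  set emb : {x // x ∈ Icc m p} ↪ ℕ := Function.Embedding.subtype _ with hemb
  set C : Fin N → Finset ℕ := fun i => Ico (m + i * k) (m + i * k + k) with hC
  have hCsub : ∀ i, C i ⊆ Icc m p := by
    intro i x hx
    have h1 := mem_Ico.1 hx
    have h2 : (i : ℕ) * k + k ≤ N * k := by
      rw [← Nat.succ_mul]
      exact Nat.mul_le_mul_right _ i.2
    rw [mem_Icc]
    omega
  have hCdisj : ∀ i j, i < j → Disjoint (C i) (C j) := by
    intro i j hij
    rw [disjoint_left]
    intro x hx hx'
    have h1 := mem_Ico.1 hx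
    have h2 := mem_Ico.1 hx'
    have h3 : (i : ℕ) * k + k ≤ j * k := by
      rw [← Nat.succ_mul]
      exact Nat.mul_le_mul_right _ hij
    omega
  have hCdisj' : ∀ i j, i ≠ j → Disjoint (C i) (C j) := by
    intro i j hij
    rcases lt_or_gt_of_ne hij with h1 | h1
    · exact hCdisj i j h1
    · exact (hCdisj j i h1).symm
  have key := mul_choose_le_of_forall_perm (α := {x // x ∈ Icc m p}) (fun S => f (S.map emb))
    (k := k) (B := B) (fun i => (C i).subtype (· ∈ Icc m p)) ?_ ?_
  · rw [Fintype.card_coe, Nat.card_Icc] at key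
    refine key.trans (Nat.mul_le_mul_left _ (le_of_eq ?_))
    refine sum_bij' (fun S _ => S.map emb) (fun S _ => S.subtype (· ∈ Icc m p)) ?_ ?_ ?_ ?_ ?_
    · intro S hS
      refine mem_powersetCard.2 ⟨?_, by rw [card_map]; exact (mem_powersetCard.1 hS).2⟩
      intro x hx
      obtain ⟨y, -, rfl⟩ := mem_map.1 hx
      exact y.2
    · intro S hS
      have hS' := mem_powersetCard.1 hS
      refine mem_powersetCard.2 ⟨subset_univ _, ?_⟩
      rw [card_subtype, filter_true_of_mem (fun x hx => hS'.1 hx), hS'.2]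
    · intro S hS
      ext x
      simp [hemb]
    · intro S hS
      exact subtype_map_of_mem (fun x hx => (mem_powersetCard.1 hS).1 hx)
    · intro S hS
      rfl
  · intro i
    rw [card_subtype, filter_true_of_mem (fun x hx => hCsub i hx)]
    simp [hC]
  · intro σ
    refine h _ ?_ ?_ ?_
    · intro i x hx
      obtain ⟨y, -, rfl⟩ := mem_map.1 hx
      exact y.2
    · intro i
      rw [card_map, card_map, card_subtype, filter_true_of_mem (fun x hx => hCsub i hx)]
      simp [hC]
    · intro i j hij
      rw [disjoint_map, disjoint_map, disjoint_left]
      intro x hx hx'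
      rw [mem_subtype] at hx hx'
      exact disjoint_left.1 (hCdisj' i j hij) hx hx'

/-! ### Counting missing sets by weight. -/

section Counting

variable {F : Finset (Finset ℕ)} {m n L : ℕ}

theorem notMem_of_not_coversNonempty {P : Finset ℕ} (hne : P.Nonempty)
    (h : ¬ CoversNonempty F P) : P ∉ F :=
  fun hP => h ⟨P, hP, hne, subset_rfl⟩

theorem filter_union_split {p : ℕ} {A e : Finset ℕ} (hA : A ⊆ Icc m p) (he : ∀ x ∈ e, p < x) :
    (A ∪ e).filter (· ≤ p) = A ∧ (A ∪ e).filter (p < ·) = e := by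
  constructor
  · ext x
    have h1 : x ∈ A → x ≤ p := fun h => (mem_Icc.1 (hA h)).2
    have h2 := he x
    simp only [mem_filter, mem_union]
    by_cases hxA : x ∈ A <;> by_cases hxe : x ∈ e <;> simp_all
  · ext x
    have h1 : x ∈ A → x ≤ p := fun h => (mem_Icc.1 (hA h)).2
    have h2 := he x
    simp only [mem_filter, mem_union]
    by_cases hxA : x ∈ A <;> by_cases hxe : x ∈ e <;> simp_all

/-- The missing sets of the form `A ∪ e`, `A` from `[m, n - L]` and `e` a rejected `r`-set at the
end, are determined by `(A, e)`. -/
theorem sum_card_le_of_split (hm : 1 ≤ m) (r k : ℕ) (hrk : 1 ≤ r)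
    (E : Finset ℕ → Finset (Finset ℕ))
    (hE : ∀ A, ∀ e ∈ E A, e ⊆ Ioc (n - L) n ∧ e.card = r ∧ ¬ CoversNonempty F (A ∪ e)) :
    ∑ A ∈ powersetCard k (Icc m (n - L)), (E A).card ≤
      ((powersetCard (k + r) (seg n) \ F).filter (fun P => ¬ P ⊆ Icc 1 (n - L))).card := by
  classical
  rw [← card_sigma]
  refine card_le_card_of_injOn (fun q => q.1 ∪ q.2) ?_ ?_
  · rintro ⟨A, e⟩ hq
    simp only [coe_sigma, Set.mem_sigma_iff, mem_coe, mem_powersetCard] at hq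
    obtain ⟨⟨hA, hAk⟩, he⟩ := hq
    obtain ⟨he1, he2, he3⟩ := hE A e he
    have hdisj : Disjoint A e := by
      rw [disjoint_left]
      intro x hx hx'
      have h1 := mem_Icc.1 (hA hx)
      have h2 := mem_Ioc.1 (he1 hx')
      omega
    obtain ⟨x, hx⟩ : e.Nonempty := card_pos.1 (by omega)
    have hxn := mem_Ioc.1 (he1 hx)
    rw [mem_coe, mem_filter, mem_sdiff, mem_powersetCard]
    refine ⟨⟨⟨?_, ?_⟩, notMem_of_not_coversNonempty ⟨x, mem_union_right _ hx⟩ he3⟩, ?_⟩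
    · intro y hy
      rw [seg, mem_Icc]
      rcases mem_union.1 hy with hy | hy
      · have := mem_Icc.1 (hA hy)
        omega
      · have := mem_Ioc.1 (he1 hy)
        omega
    · rw [card_union_of_disjoint hdisj, hAk, he2]
    · intro hsub
      have := mem_Icc.1 (hsub (mem_union_right _ hx))
      omega
  · rintro ⟨A, e⟩ hq ⟨A', e'⟩ hq' heq
    simp only [coe_sigma, Set.mem_sigma_iff, mem_coe, mem_powersetCard] at hq hq'
    have h1 := filter_union_split hq.1.1
      (fun x hx => (mem_Ioc.1 ((hE A e hq.2).1 hx)).1)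
    have h2 := filter_union_split hq'.1.1
      (fun x hx => (mem_Ioc.1 ((hE A' e' hq'.2).1 hx)).1)
    have heq' : A ∪ e = A' ∪ e' := heq
    rw [heq'] at h1
    obtain rfl : A' = A := h2.1.symm.trans h1.1
    obtain rfl : e' = e := h2.2.symm.trans h1.2
    rfl

theorem sum_card_rejectedSingles_le (hm : 1 ≤ m) :
    ∑ A ∈ powersetCard (m - 1) (Icc m (n - L)),
        (rejectedSingles (CoversNonempty F) n L A).card ≤
      ((powersetCard m (seg n) \ F).filter (fun P => ¬ P ⊆ Icc 1 (n - L))).card := by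
  classical
  have := sum_card_le_of_split (F := F) (n := n) (L := L) hm 1 (m - 1) le_rfl
    (fun A => (rejectedSingles (CoversNonempty F) n L A).image singleton) ?_
  · rw [Nat.sub_add_cancel hm] at this
    refine le_trans (le_of_eq (sum_congr rfl fun A _ => ?_)) this
    rw [card_image_of_injective _ singleton_injective]
  · intro A e he
    obtain ⟨x, hx, rfl⟩ := mem_image.1 he
    have hx' := mem_filter.1 hx
    refine ⟨singleton_subset_iff.2 hx'.1, card_singleton x, ?_⟩
    rw [union_comm, ← insert_eq]
    exact hx'.2

theorem sum_card_rejectedPairs_le (hm : 1 ≤ m) :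
    ∑ A ∈ powersetCard (m - 1) (Icc m (n - L)),
        (rejectedPairs (CoversNonempty F) n L A).card ≤ missing n F (m + 1) := by
  classical
  have := sum_card_le_of_split (F := F) (n := n) (L := L) hm 2 (m - 1) (by omega)
    (rejectedPairs (CoversNonempty F) n L) ?_
  · rw [show m - 1 + 2 = m + 1 by omega] at this
    exact this.trans (card_le_card (filter_subset _ _))
  · intro A e he
    have he' := mem_filter.1 he
    exact ⟨(mem_powersetCard.1 he'.1).1, (mem_powersetCard.1 he'.1).2, he'.2⟩

/-- A missing m-set inside [n-L] arises as `insert x A` at most once for each of its m elements x.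
-/
theorem sum_card_rejectedLow_le (hm : 1 ≤ m) :
    ∑ A ∈ powersetCard (m - 1) (Icc m (n - L)), (rejectedLow (CoversNonempty F) n L A).card ≤
      m * ((powersetCard m (seg n) \ F).filter (fun P => P ⊆ Icc 1 (n - L))).card := by
  classical
  rw [← card_sigma]
  refine card_le_mul_card_image_of_maps_to (f := fun q => insert q.2 q.1) ?_ m ?_
  · rintro ⟨A, x⟩ hq
    simp only [mem_sigma, mem_powersetCard] at hq
    obtain ⟨⟨hA, hAk⟩, hx⟩ := hq
    simp only [rejectedLow, mem_filter, mem_sdiff] at hx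
    have hsub : insert x A ⊆ Icc 1 (n - L) := by
      refine insert_subset hx.1.1 (hA.trans (Icc_subset_Icc_left hm))
    refine mem_filter.2 ⟨mem_sdiff.2 ⟨mem_powersetCard.2 ⟨?_, ?_⟩, ?_⟩, hsub⟩
    · exact hsub.trans (Icc_subset_Icc_right (Nat.sub_le _ _))
    · rw [card_insert_of_notMem hx.1.2, hAk]
      omega
    · exact notMem_of_not_coversNonempty (insert_nonempty _ _) hx.2
  · intro P hP
    have hPcard := (mem_powersetCard.1 (mem_sdiff.1 (mem_filter.1 hP).1).1).2
    rw [← hPcard]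
    refine card_le_card_of_injOn (fun q => q.2) ?_ ?_
    · rintro ⟨A, x⟩ hq
      have := (mem_filter.1 hq).2
      dsimp only at this ⊢
      rw [← this]
      exact mem_insert_self _ _
    · rintro ⟨A, x⟩ hq ⟨A', x'⟩ hq' heq
      obtain rfl : x = x' := heq
      have h1 := mem_filter.1 hq
      have h2 := mem_filter.1 hq'
      have hx : x ∉ A := (mem_sdiff.1 (mem_filter.1 (mem_sigma.1 h1.1).2).1).2
      have hx' : x ∉ A' := (mem_sdiff.1 (mem_filter.1 (mem_sigma.1 h2.1).2).1).2
      have h3 : insert x A = insert x A' := h1.2.trans h2.2.symm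
      have : A = A' := by rw [← erase_insert hx, h3, erase_insert hx']
      rw [this]

/-- Missing m-sets meeting the block are counted once with factor m, those inside [n-L] up to m
times with factor 1; the two classes are disjoint. -/
theorem sum_weight_le (hm : 1 ≤ m) :
    ∑ A ∈ powersetCard (m - 1) (Icc m (n - L)), weight (CoversNonempty F) m n L A ≤
      m * (missing n F m + missing n F (m + 1)) := by
  classical
  simp only [weight, sum_add_distrib, ← mul_sum]
  have h1 := sum_card_rejectedSingles_le (F := F) (n := n) (L := L) hm
  have h2 := sum_card_rejectedPairs_le (F := F) (n := n) (L := L) hm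
  have h3 := sum_card_rejectedLow_le (F := F) (n := n) (L := L) hm
  have h4 := card_filter_add_card_filter_not (s := powersetCard m (seg n) \ F)
    (fun P => P ⊆ Icc 1 (n - L))
  have h5 : missing n F m = (powersetCard m (seg n) \ F).card := rfl
  rw [h5, ← h4]
  nlinarith [Nat.mul_le_mul_left m h1, Nat.mul_le_mul_left m h2]

end Counting

/-! ### Extra members from non-containment in Q and W. -/

section Obstructions

variable {F : Finset (Finset ℕ)} {m s c n : ℕ}

theorem card_filter_le_of_subset_seg {P : Finset ℕ} (hP : P ⊆ seg n) (d : ℕ) :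
    (P.filter (· ≤ d)).card = (P ∩ seg d).card := by
  congr 1
  ext x
  simp only [mem_filter, mem_inter, seg, mem_Icc]
  constructor
  · intro h
    exact ⟨h.1, (mem_Icc.1 (hP h.1)).1, h.2⟩
  · intro h
    exact ⟨h.1, h.2.2⟩

theorem card_filter_lt_le {P : Finset ℕ} (hP : P ⊆ seg n) (d : ℕ) :
    (P.filter (d < ·)).card ≤ n - d := by
  rw [← Nat.card_Ioc]
  refine card_le_card fun x hx => ?_
  have h1 := mem_filter.1 hx
  exact mem_Ioc.2 ⟨h1.2, (mem_Icc.1 (hP h1.1)).2⟩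

/-- A member outside Q with a elements up to n-2c-1 and b ≤ 2c+1 beyond has 2a + b ≤ 2m - 1. Taking
j = ⌊b/2⌋ gives a ≤ m-1-j and b ≤ 2j+1, and compression does the rest. -/
theorem exists_covers_of_not_subset_familyQ (hF : F ⊆ (seg n).powerset) (hs : IsShifted n F)
    (hn : n = m * s + c) (h : ¬ F ⊆ familyQ m s c) :
    ∃ j ≤ c, j ≤ m - 1 ∧
      Covers F (Icc 1 (m - 1 - j) ∪ Ioc (n - 2 * c - 1) (n - 2 * c - 1 + (2 * j + 1))) := by
  obtain ⟨P, hPF, hPQ⟩ := not_subset.1 h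
  have hPn := mem_powerset.1 (hF hPF)
  have hlt : P.card + (P ∩ seg (n - 2 * c - 1)).card < 2 * m := by
    by_contra! hcon
    refine hPQ (mem_filter.2 ⟨mem_powerset.2 (by rwa [← hn]), ?_⟩)
    rwa [show m * s - c - 1 = n - 2 * c - 1 by omega]
  have h1 := card_filter_le_of_subset_seg hPn (n - 2 * c - 1)
  have h2 := card_filter_lt_le hPn (n - 2 * c - 1)
  have h3 := card_filter_add_card_filter_not (s := P) (· ≤ n - 2 * c - 1)
  simp only [not_le] at h3
  refine ⟨(P.filter (n - 2 * c - 1 < ·)).card / 2, by omega, by omega, ?_⟩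
  exact (isShiftUpper_covers hF hs).compress (fun p hp => (mem_Icc.1 (hPn hp)).1) _ _ _
    (by omega) (by omega) ⟨P, hPF, subset_rfl⟩

theorem covers_of_not_subset_familyW (hF : F ⊆ (seg n).powerset) (hs : IsShifted n F)
    (hn : n = m * s + 1) (h : ¬ F ⊆ familyW m s 1) :
    Covers F (Icc 1 (m - 1) ∪ Ioc (n - 2) (n - 2 + 2)) := by
  obtain ⟨P, hPF, hPW⟩ := not_subset.1 h
  have hPn := mem_powerset.1 (hF hPF)
  have hlt : (P ∩ seg (n - 2)).card < m := by
    by_contra! hcon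
    refine hPW (mem_filter.2 ⟨mem_powerset.2 (by rwa [← hn]), ?_⟩)
    rwa [show m * s - 1 = n - 2 by omega]
  have h1 := card_filter_le_of_subset_seg hPn (n - 2)
  have h2 := card_filter_lt_le hPn (n - 2)
  exact (isShiftUpper_covers hF hs).compress (fun p hp => (mem_Icc.1 (hPn hp)).1) _ _ _
    (by omega) (by omega) ⟨P, hPF, subset_rfl⟩

end Obstructions

/-! ### Error terms. -/

section Asymptotics

theorem choose_add_le (k v d : ℕ) :
    (v + d).choose (k + 1) ≤ v.choose (k + 1) + d * (v + d).choose k := by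
  induction d with
  | zero => simp
  | succ d ih =>
    rw [← add_assoc, Nat.choose_succ_succ]
    have h1 : (v + d).choose k ≤ (v + d + 1).choose k := Nat.choose_le_choose _ (Nat.le_succ _)
    have h2 := Nat.mul_le_mul_left d h1
    have h3 : (d + 1) * (v + d + 1).choose k = d * (v + d + 1).choose k + (v + d + 1).choose k := by
      ring
    simp only [Nat.succ_eq_add_one]
    omega

theorem choose_le_pow_mul {k n C s : ℕ} (hn : n ≤ C * s) : n.choose k ≤ C ^ k * s ^ k := by
  rw [← mul_pow]
  exact (Nat.choose_le_pow n k).trans (Nat.pow_le_pow_left hn k)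

/-- The bound for all large `s`, cleared of denominators. -/
theorem le_mul_missing {F : Finset (Finset ℕ)} {m n s c L M : ℕ} (hm : 1 ≤ m) (hc : 1 ≤ c)
    (hn : n = m * s + c) (hL : L = 16 * (c + 1)) (hM : M = 16 * m * (c + 1))
    (hs : m * M + 2 * L ≤ s) (hF : F ⊆ (seg n).powerset) (hshift : IsShifted n F)
    (hν : matchingNumber F < s)
    (hQ : ∃ j ≤ c, j ≤ m - 1 ∧
      Covers F (Icc 1 (m - 1 - j) ∪ Ioc (n - 2 * c - 1) (n - 2 * c - 1 + (2 * j + 1))))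
    (hW : c = 1 → Covers F (Icc 1 (m - 1) ∪ Ioc (n - 2) (n - 2 + 2))) :
    (2 * c + 2) * (s - 1 + M - 3 * L) * (n - L + 1 - m).choose (m - 1) ≤
      (s - 1 + M) * (missing n F m + missing n F (m + 1)) := by
  have hMm : M ≤ m * M := Nat.le_mul_of_pos_left M hm
  have key := mul_choose_le_of_forall_disjoint (weight (CoversNonempty F) m n L)
    (m := m) (p := n - L) (k := m - 1) (N := s - 1 + M)
    (B := m * (2 * c + 2) * (s - 1 + M - 3 * L)) ?_ ?_
  · have h2 := Nat.mul_le_mul_left (s - 1 + M) (sum_weight_le (F := F) (n := n) (L := L) hm)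
    refine Nat.le_of_mul_le_mul_left ?_ hm
    calc m * ((2 * c + 2) * (s - 1 + M - 3 * L) * (n - L + 1 - m).choose (m - 1))
        = m * (2 * c + 2) * (s - 1 + M - 3 * L) * (n - L + 1 - m).choose (m - 1) := by ring
      _ ≤ _ := key.trans h2
      _ = _ := by ring
  -- The M spare sets occupy M(m-1) elements, hence the term mM in the lower bound on s.
  · obtain ⟨m', rfl⟩ : ∃ m', m = m' + 1 := ⟨m - 1, by omega⟩
    obtain ⟨s', rfl⟩ : ∃ s', s = s' + 1 := ⟨s - 1, by omega⟩
    have h1 : n = s' * m' + m' + s' + 1 + c := by rw [hn]; ring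
    have h2 : (s' + 1 - 1 + M) * (m' + 1 - 1) = s' * m' + M * m' := by
      simp only [Nat.add_sub_cancel]; ring
    have h3 : (m' + 1) * M = M * m' + M := by ring
    omega
  · intro A hA hAcard hAdisj
    exact le_sum_weight (isShiftUpper_coversNonempty hF hshift) hν hm hc hn hL hM (by omega) hA
      hAcard hAdisj (by simp) hQ hW

/-- Two losses of order s^(m-2): shrinking the ground set costs at most (L+m)·C(n, m-2), and the
factor 1 - 3L/N costs 3L/N times a binomial of order s^(m-1), where N ≥ s. -/
theorem bound_of_le_mul {m c s n L N y : ℕ} (hm : 2 ≤ m) (hn : n = m * s + c) (hcs : c ≤ s)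
    (hs : L + m ≤ s) (hN : s ≤ N) (h3L : 3 * L ≤ N)
    (h : (2 * c + 2) * (N - 3 * L) * (n - L + 1 - m).choose (m - 1) ≤ N * y) :
    (2 * (c : ℝ) + 2) * (n.choose (m - 1) : ℝ) -
      (2 * c + 2) * ((L + m) * (m + 1) ^ (m - 2) + 3 * L * (m + 1) ^ (m - 1)) * (s : ℝ) ^ (m - 2)
        ≤ y := by
  obtain ⟨k, rfl⟩ : ∃ k, m = k + 2 := ⟨m - 2, by omega⟩
  simp only [show k + 2 - 1 = k + 1 by omega, show k + 2 - 2 = k by omega] at h ⊢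
  set v := n - L + 1 - (k + 2) with hv
  have hns : n ≤ (k + 2 + 1) * s := by rw [hn]; linarith [add_mul (k + 2) 1 s]
  have hsn : (k + 2) + L ≤ n := by
    have : 1 * s ≤ (k + 2) * s := Nat.mul_le_mul_right s (by omega)
    omega
  have hvd : n = v + (L + k + 1) := by omega
  have hc1 : n.choose (k + 1) ≤ v.choose (k + 1) + (L + (k + 2)) * n.choose k := by
    have h1 := choose_add_le k v (L + k + 1)
    rw [← hvd] at h1
    refine h1.trans (Nat.add_le_add_left (Nat.mul_le_mul_right _ (by omega)) _)
  have hc2 : n.choose k ≤ (k + 2 + 1) ^ k * s ^ k := choose_le_pow_mul hns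
  have hc3 : v.choose (k + 1) ≤ (k + 2 + 1) ^ (k + 1) * s ^ (k + 1) :=
    choose_le_pow_mul ((show v ≤ n by omega).trans hns)
  have hc1' : (n.choose (k + 1) : ℝ) ≤ v.choose (k + 1) + (L + (k + 2)) * n.choose k := by
    exact_mod_cast hc1
  have hc2' : (n.choose k : ℝ) ≤ (k + 2 + 1) ^ k * (s : ℝ) ^ k := by exact_mod_cast hc2
  have hc3' : (v.choose (k + 1) : ℝ) ≤ (k + 2 + 1) ^ (k + 1) * (s : ℝ) ^ k * s := by
    rw [mul_assoc, ← pow_succ]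
    exact_mod_cast hc3
  have h' : (2 * (c : ℝ) + 2) * (N - 3 * L) * v.choose (k + 1) ≤ N * y := by
    have := (Nat.cast_le (α := ℝ)).2 h
    push_cast [Nat.cast_sub h3L] at this
    exact this
  have hs0 : (0 : ℝ) < s := by
    have : 0 < s := by omega
    exact_mod_cast this
  have hNs : (s : ℝ) ≤ N := by exact_mod_cast hN
  have hN0 : (0 : ℝ) < N := hs0.trans_le hNs
  have hX : (0 : ℝ) ≤ (k + 2 + 1) ^ (k + 1) * (s : ℝ) ^ k := by positivity
  have h4 : (2 * (c : ℝ) + 2) * v.choose (k + 1) -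
      (2 * c + 2) * (3 * L * ((k + 2 + 1) ^ (k + 1) * (s : ℝ) ^ k)) ≤ y := by
    have h5 : (v.choose (k + 1) : ℝ) ≤ (k + 2 + 1) ^ (k + 1) * (s : ℝ) ^ k * N :=
      hc3'.trans (mul_le_mul_of_nonneg_left hNs hX)
    have h6 : (2 * (c : ℝ) + 2) * (3 * L) * v.choose (k + 1) ≤
        (2 * (c : ℝ) + 2) * (3 * L) * ((k + 2 + 1) ^ (k + 1) * (s : ℝ) ^ k * N) :=
      mul_le_mul_of_nonneg_left h5 (by positivity)
    refine le_of_mul_le_mul_left ?_ hN0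
    linarith
  have h7 : (L + (k + 2) : ℝ) * n.choose k ≤ (L + (k + 2)) * ((k + 2 + 1) ^ k * (s : ℝ) ^ k) :=
    mul_le_mul_of_nonneg_left hc2' (by positivity)
  have h8 : (2 * (c : ℝ) + 2) * n.choose (k + 1) ≤
      (2 * c + 2) * (v.choose (k + 1) + (L + (k + 2)) * ((k + 2 + 1) ^ k * (s : ℝ) ^ k)) :=
    mul_le_mul_of_nonneg_left (by linarith) (by positivity)
  push_cast
  linarith

end Asymptotics

end SetFamily

theorem theoremt (m c : ℕ) (hm : 2 ≤ m) (hc : 1 ≤ c) :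
    ∃ K : ℝ, ∀ s : ℕ, c ≤ s →
      ∀ F : Finset (Finset ℕ), F ⊆ (SetFamily.seg (m * s + c)).powerset →
        SetFamily.IsShifted (m * s + c) F →
        SetFamily.matchingNumber F < s →
        ((2 ≤ c ∧ ¬ F ⊆ SetFamily.familyQ m s c) ∨
          (c = 1 ∧ ¬ F ⊆ SetFamily.familyQ m s c ∧ ¬ F ⊆ SetFamily.familyW m s c)) →
        (2 * (c : ℝ) + 2) * ((m * s + c).choose (m - 1) : ℝ) - K * (s : ℝ) ^ (m - 2) ≤
          (SetFamily.missing (m * s + c) F m : ℝ) +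
            (SetFamily.missing (m * s + c) F (m + 1) : ℝ) := by
  obtain ⟨L, hL⟩ : ∃ L, L = 16 * (c + 1) := ⟨_, rfl⟩
  obtain ⟨M, hM⟩ : ∃ M, M = 16 * m * (c + 1) := ⟨_, rfl⟩
  obtain ⟨s₀, hs₀⟩ : ∃ s₀, s₀ = m * M + 2 * L + m := ⟨_, rfl⟩
  set K₁ : ℝ := (2 * c + 2) * ((L + m) * (m + 1) ^ (m - 2) + 3 * L * (m + 1) ^ (m - 1)) with hK₁
  -- For s < s₀ this constant makes the left side nonpositive; K₁ serves s ≥ s₀.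
  set K₂ : ℝ := (2 * c + 2) * ((m + 1) ^ (m - 1) * s₀) with hK₂
  refine ⟨max K₁ K₂, ?_⟩
  intro s hcs F hF hshift hν hcase
  have hpow : (0 : ℝ) ≤ (s : ℝ) ^ (m - 2) := by positivity
  by_cases hs : s₀ ≤ s
  · have hQ := SetFamily.exists_covers_of_not_subset_familyQ hF hshift rfl
      (hcase.elim (fun h => h.2) (fun h => h.2.1))
    have hW : c = 1 → SetFamily.Covers F (Finset.Icc 1 (m - 1) ∪
        Finset.Ioc (m * s + c - 2) (m * s + c - 2 + 2)) := by
      rintro rfl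
      rcases hcase with h | h
      · omega
      · exact SetFamily.covers_of_not_subset_familyW hF hshift rfl h.2.2
    have h1 := SetFamily.le_mul_missing (by omega) hc rfl hL hM (by omega) hF hshift hν hQ hW
    have h2 := SetFamily.bound_of_le_mul hm rfl hcs (by omega)
      (by
        have : 0 < M := by rw [hM]; positivity
        omega)
      (by
        have : L ≤ M := by rw [hL, hM]; nlinarith
        omega) h1
    push_cast at h2
    have h3 : K₁ * (s : ℝ) ^ (m - 2) ≤ max K₁ K₂ * (s : ℝ) ^ (m - 2) :=
      mul_le_mul_of_nonneg_right (le_max_left _ _) hpow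
    linarith
  · have h1 : (m * s + c).choose (m - 1) ≤ (m + 1) ^ (m - 1) * s ^ (m - 1) :=
      SetFamily.choose_le_pow_mul (by linarith [add_mul m 1 s])
    have h2 : s ^ (m - 1) ≤ s₀ * s ^ (m - 2) := by
      rw [show m - 1 = m - 2 + 1 by omega, pow_succ, mul_comm]
      exact Nat.mul_le_mul_right _ (by omega)
    have h3 : ((m * s + c).choose (m - 1) : ℝ) ≤ (m + 1) ^ (m - 1) * (s₀ * (s : ℝ) ^ (m - 2)) := by
      exact_mod_cast h1.trans (Nat.mul_le_mul_left _ h2)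
    have h4 : (2 * (c : ℝ) + 2) * ((m * s + c).choose (m - 1) : ℝ) ≤
        (2 * c + 2) * ((m + 1) ^ (m - 1) * (s₀ * (s : ℝ) ^ (m - 2))) :=
      mul_le_mul_of_nonneg_left h3 (by positivity)
    have h5 : K₂ * (s : ℝ) ^ (m - 2) ≤ max K₁ K₂ * (s : ℝ) ^ (m - 2) :=
      mul_le_mul_of_nonneg_right (le_max_right _ _) hpow
    have h6 : (0 : ℝ) ≤ (SetFamily.missing (m * s + c) F m : ℝ) +
      (SetFamily.missing (m * s + c) F (m + 1) : ℝ) := by positivity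
    rw [hK₂] at h5
    linarith
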